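/- Let $d_x,d_y,d_g$ be non-negative integers, let $\mathcal B\subset\mathbb R^{d_y}$ be open, let $g\in C^1(\mathbb R^{d_x}\times\mathcal B;\mathbb R^{d_g})$, and let $\mu_x$ be a Borel probability measure on $\mathbb R^{d_x}$. Write $D_yg(x,y)\in\mathbb R^{d_g\times d_y}$ for the Jacobian matrix of $g(x,\cdot)$ at $y$, and $\|\cdot\|_F$ for the Frobenius norm. Suppose that for some $p\in[1,\infty)$: 1. for every $y\in\mathcal B$, $g(\cdot,y)\in L^p_{\mu_x}(\mathbb R^{d_x};\mathbb R^{d_g})$, and the map $\mathcal B\ni y\mapsto g(\cdot,y)\in L^p_{\mu_x}(\mathbb R^{d_x};\mathbb R^{d_g})$ is continuous; 2. for every $y\in\mathcal B$, $D_yg(\cdot,y)\in L^p_{\mu_x}(\mathbb R^{d_x};\mathbb R^{d_g\times d_y})$, and the map $\mathcal B\ni y\mapsto D_yg(\cdot,y)\in L^p_{\mu_x}(\mathbb R^{d_x};\mathbb R^{d_g\times d_y})$ is continuous, where $\mathbb R^{d_g\times d_y}$ carries $\|\cdot\|_F$. A GELU neural network $g_\theta:\mathbb R^{d_x}\times\mathbb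 R^{d_y}\to\mathbb R^{d_g}$ is a map $g_\theta(x,y)=a_{L+1}$ with $a_0=(x,y)\in\mathbb R^{d_x+d_y}$, $a_i=\sigma(W_{i-1}a_{i-1}+b_{i-1})$ for $1\le i\le L$ and $a_{L+1}=W_La_L+b_L$, for some number $L\ge1$ of hidden layers, some finite widths, and some real weight matrices $W_i$ and bias vectors $b_i$ of matching sizes, where $\sigma(t)=t\,\Phi(t)$ is applied to each entry and $\Phi$ is the cumulative distribution function of the standard Gaussian distribution on $\mathbb R$. Then for any $\epsilon>0$ and any compact set $K_y\subset\mathcal B$ there exists a GELU neural network $g_\theta$ such that $$\sup_{y\in K_y}\Big(\mathbb E_{x\sim\mu_x}\big[\|g(x,y)-g_\theta(x,y)\|_2^p\big]+\mathbb E_{x\sim\mu_x}\big[\|D_yg(x,y)-D_yg_\theta(x,y)\|_F^p\big]\Big)<\epsilon^p .$$ (The supremum over an empty $K_y$ is $0$.) -/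

import Mathlib

open MeasureTheory ProbabilityTheory
open scoped ENNReal Matrix

-- Matrices carry the Frobenius norm throughout.
attribute [local instance] Matrix.frobeniusNormedAddCommGroup

/-- The Gaussian error linear unit `t ↦ t * Φ(t)`, with `Φ` the cumulative distribution function of
the standard Gaussian distribution on `ℝ`. -/
noncomputable def gelu (t : ℝ) : ℝ :=
  t * cdf (gaussianReal 0 1) t

/-- The parameters `θ` of a dense feedforward network from `ℝ^m` to `ℝ^n`: a list of weight matrices
and bias vectors of matching sizes. `hidden W b N` applies a hidden layer with weights `W` and
biases `b` first and `N` afterwards; the last layer is `output W b`. -/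
inductive DenseNet (n : ℕ) : ℕ → Type
  | output {m : ℕ} (W : Matrix (Fin n) (Fin m) ℝ) (b : Fin n → ℝ) : DenseNet n m
  | hidden {m k : ℕ} (W : Matrix (Fin k) (Fin m) ℝ) (b : Fin k → ℝ) (N : DenseNet n k) :
      DenseNet n m

namespace DenseNet

/-- The number of hidden layers. -/
def depth {n : ℕ} : {m : ℕ} → DenseNet n m → ℕ
  | _, output _ _ => 0
  | _, hidden _ _ N => N.depth + 1

/-- The map realized by a network with activation function `σ`: every hidden layer maps `a` to
`σ (W a + b)`, with `σ` applied to each entry, and the output layer maps `a` to `W a + b`. -/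
def eval (σ : ℝ → ℝ) {n : ℕ} : {m : ℕ} → DenseNet n m → (Fin m → ℝ) → Fin n → ℝ
  | _, output W b, a => W *ᵥ a + b
  | _, hidden W b N, a => N.eval σ (fun i => σ ((W *ᵥ a + b) i))

/-- The function `g_θ : ℝ^dx × ℝ^dy → ℝ^dg` of a GELU network whose input is the concatenation of
`x` and `y`. -/
noncomputable def toFun {dx dy dg : ℕ} (θ : DenseNet dg (dx + dy))
    (x : EuclideanSpace ℝ (Fin dx)) (y : EuclideanSpace ℝ (Fin dy)) :
    EuclideanSpace ℝ (Fin dg) :=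
  WithLp.toLp 2 (θ.eval gelu (Fin.append (fun i => x i) (fun j => y j)))

end DenseNet

/-- The partial Jacobian `D_y g(x, y)`, as a `dg × dy` matrix: its entry `(i, j)` is the derivative
of the `i`-th component of `g(x, ·)` at `y` in the direction of the `j`-th coordinate. -/
noncomputable def jacobianY {dx dy dg : ℕ}
    (g : EuclideanSpace ℝ (Fin dx) → EuclideanSpace ℝ (Fin dy) → EuclideanSpace ℝ (Fin dg))
    (x : EuclideanSpace ℝ (Fin dx)) (y : EuclideanSpace ℝ (Fin dy)) :
    Matrix (Fin dg) (Fin dy) ℝ :=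
  Matrix.of fun i j => fderiv ℝ (g x) y (EuclideanSpace.single j 1) i

/-!
Everything is done for first-order jets in `y`, that is, for a function together with its partial
derivatives, and the approximating networks are only required to be close in `L^p(μ)` as functions
of `x`, uniformly in `y ∈ K`.

Since `gelu t - gelu (-t) = t`, a hidden layer can carry its inputs along unchanged, so every
expression built from the inputs by linear combinations and `gelu` is computed by a dense network.
The second-order Taylor term of `gelu` at `0`, rescaled, gives squares and hence products of
bounded expressions, together with their derivatives. A second difference of `gelu` is a bump
vanishing at infinity; products of squares of such bumps approximate functions of `x` in `L^p(μ)`,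
by Stone–Weierstrass on the one-point compactification, and provide an integrable nonnegative kernel
`k` in the variable `y`.

Multiply `g` by a cutoff `χ` equal to `1` near `K` and supported in `B`. As a map into `L^p(μ)`,
`h = χ g` is continuous with compact support and has continuous partial derivatives, so its jet is
the limit of the jets of the convolutions `∫ k_c(y - z) h(z) dz` with the rescaled kernels `k_c`. By
parts, all derivatives fall on `k_c`, so these jets are integrals of jets of `k_c(y - z) h(z)`,
whose factors are limits of networks in `y` and in `x`. The integrals stay in the closed subspace
spanned by the jets of networks.
-/

open Filter Topology NNReal
/-! ### The Gaussian error linear unit -/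

lemma differentiable_gaussianPDFReal (m : ℝ) (v : ℝ≥0) :
    Differentiable ℝ (gaussianPDFReal m v) := by
  unfold gaussianPDFReal
  fun_prop

lemma gaussianPDFReal_zero_neg (v : ℝ≥0) (t : ℝ) :
    gaussianPDFReal 0 v (-t) = gaussianPDFReal 0 v t := by
  simp [gaussianPDFReal]

lemma cdf_gaussianReal_eq_integral (m : ℝ) {v : ℝ≥0} (hv : v ≠ 0) (t : ℝ) :
    cdf (gaussianReal m v) t = ∫ s in Set.Iic t, gaussianPDFReal m v s := by
  rw [cdf_eq_real, measureReal_def, gaussianReal_apply_eq_integral _ hv, ENNReal.toReal_ofReal]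
  exact integral_nonneg fun s => gaussianPDFReal_nonneg _ _ _

lemma hasDerivAt_cdf_gaussianReal (m : ℝ) {v : ℝ≥0} (hv : v ≠ 0) (t : ℝ) :
    HasDerivAt (cdf (gaussianReal m v)) (gaussianPDFReal m v t) t := by
  have hcdf : (cdf (gaussianReal m v) : ℝ → ℝ) =
      fun t => cdf (gaussianReal m v) 0 + ∫ s in (0 : ℝ)..t, gaussianPDFReal m v s := by
    ext t
    have hi := integrable_gaussianPDFReal m v
    rw [cdf_gaussianReal_eq_integral m hv, cdf_gaussianReal_eq_integral m hv,
      ← intervalIntegral.integral_Iic_sub_Iic hi.integrableOn hi.integrableOn]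
    ring
  have hc := (differentiable_gaussianPDFReal m v).continuous
  rw [hcdf]
  exact (intervalIntegral.integral_hasDerivAt_right (hc.intervalIntegrable _ _)
    (hc.stronglyMeasurableAtFilter _ _) hc.continuousAt).const_add _

lemma strictMono_cdf_gaussianReal (m : ℝ) {v : ℝ≥0} (hv : v ≠ 0) :
    StrictMono (cdf (gaussianReal m v)) :=
  strictMono_of_deriv_pos fun t => by
    rw [(hasDerivAt_cdf_gaussianReal m hv t).deriv]
    exact gaussianPDFReal_pos _ _ _ hv

lemma cdf_gaussianReal_zero_neg {v : ℝ≥0} (hv : v ≠ 0) (t : ℝ) :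
    cdf (gaussianReal 0 v) (-t) = 1 - cdf (gaussianReal 0 v) t := by
  let F : ℝ → ℝ := fun t => cdf (gaussianReal 0 v) (-t) + cdf (gaussianReal 0 v) t
  have hF : ∀ t, HasDerivAt F 0 t := fun t => by
    refine (((hasDerivAt_cdf_gaussianReal 0 hv (-t)).scomp t (hasDerivAt_neg t)).add
      (hasDerivAt_cdf_gaussianReal 0 hv t)).congr_deriv ?_
    simp [gaussianPDFReal_zero_neg]
  have hconst := is_const_of_deriv_eq_zero (fun t => (hF t).differentiableAt) fun t => (hF t).deriv
  have hlim : Tendsto F atTop (𝓝 (0 + 1)) :=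
    ((tendsto_cdf_atBot _).comp tendsto_neg_atTop_atBot).add (tendsto_cdf_atTop _)
  have h1 := tendsto_nhds_unique hlim (tendsto_const_nhds.congr fun s => hconst t s)
  change _ = cdf (gaussianReal 0 v) (-t) + cdf (gaussianReal 0 v) t at h1
  linarith

lemma cdf_gaussianReal_zero_neg_le (v : ℝ≥0) {t : ℝ} (ht : 0 < t) :
    cdf (gaussianReal 0 v) (-t) ≤ v / t ^ 2 := by
  have chebyshev := meas_ge_le_variance_div_sq (μ := gaussianReal 0 v) (X := id)
    (memLp_id_gaussianReal (μ := 0) (v := v) 2) ht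
  rw [variance_id_gaussianReal] at chebyshev
  simp only [id, integral_id_gaussianReal, sub_zero] at chebyshev
  rw [cdf_eq_real, measureReal_def]
  refine ENNReal.toReal_le_of_le_ofReal (by positivity) (le_trans (measure_mono ?_) chebyshev)
  intro x (hx : x ≤ -t)
  exact le_abs.2 (Or.inr (le_neg_of_le_neg hx))

lemma hasDerivAt_gelu (t : ℝ) :
    HasDerivAt gelu (cdf (gaussianReal 0 1) t + t * gaussianPDFReal 0 1 t) t :=
  ((hasDerivAt_id t).mul (hasDerivAt_cdf_gaussianReal 0 one_ne_zero t)).congr_deriv (by simp)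

lemma hasDerivAt_deriv_gelu_zero : HasDerivAt (deriv gelu) (2 * gaussianPDFReal 0 1 0) 0 := by
  rw [funext fun t => (hasDerivAt_gelu t).deriv]
  refine ((hasDerivAt_cdf_gaussianReal 0 one_ne_zero 0).add ((hasDerivAt_id (0 : ℝ)).mul
    (differentiable_gaussianPDFReal 0 1 0).hasDerivAt)).congr_deriv ?_
  simp only [id_eq]
  ring

lemma contDiff_gelu : ContDiff ℝ 1 gelu := by
  rw [contDiff_one_iff_deriv]
  refine ⟨fun t => (hasDerivAt_gelu t).differentiableAt, ?_⟩
  rw [funext fun t => (hasDerivAt_gelu t).deriv]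
  exact (continuous_iff_continuousAt.2 fun t =>
    (hasDerivAt_cdf_gaussianReal 0 one_ne_zero t).continuousAt).add
      (continuous_id.mul (differentiable_gaussianPDFReal 0 1).continuous)

lemma gelu_sub_gelu_neg (t : ℝ) : gelu t - gelu (-t) = t := by
  rw [gelu, gelu, cdf_gaussianReal_zero_neg one_ne_zero]
  ring

lemma abs_gelu_sub_max_le (t : ℝ) : |gelu t - max t 0| ≤ 1 / |t| := by
  have tail : ∀ s, 0 < s → s * cdf (gaussianReal 0 1) (-s) ≤ 1 / s := fun s hs => by
    calc s * cdf (gaussianReal 0 1) (-s) ≤ s * (1 / s ^ 2) := by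
          gcongr; simpa using cdf_gaussianReal_zero_neg_le 1 hs
      _ = 1 / s := by field_simp
  rcases lt_trichotomy t 0 with ht | rfl | ht
  · rw [max_eq_right ht.le, sub_zero, gelu, abs_mul, abs_of_neg ht, abs_of_nonneg (cdf_nonneg _ _)]
    simpa using tail (-t) (neg_pos.2 ht)
  · simp [gelu]
  · have e : gelu t - t = -(t * cdf (gaussianReal 0 1) (-t)) := by
      rw [gelu, cdf_gaussianReal_zero_neg one_ne_zero]; ring
    rw [max_eq_left ht.le, abs_of_pos ht, e, abs_neg,
      abs_of_nonneg (mul_nonneg ht.le (cdf_nonneg _ _))]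
    exact tail t ht

lemma exists_rescale_near_id {f : ℝ → ℝ} {a : ℝ} (ha : a ≠ 0) (hf : HasDerivAt f a 0) (M : ℝ)
    {η : ℝ} (hη : 0 < η) :
    ∃ d : ℝ, 0 < d ∧ ∀ u, |u| ≤ M → |u - (f (d * u) - f 0) / (a * d)| ≤ η := by
  set N := max M 1
  have hN : 0 < N := by positivity
  have : 0 < |a| := abs_pos.2 ha
  obtain ⟨r, hr, hlin⟩ := Metric.eventually_nhds_iff_ball.1 <| Asymptotics.isLittleO_iff.1
    (hasDerivAt_iff_isLittleO.1 hf) (show 0 < η * |a| / N by positivity)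
  set d := r / (2 * N) with hd
  have hd0 : 0 < d := by positivity
  refine ⟨d, hd0, fun u hu => ?_⟩
  replace hu : |u| ≤ N := hu.trans (le_max_left _ _)
  have hdu : |d * u| < r := by
    rw [abs_mul, abs_of_pos hd0]
    calc d * |u| ≤ d * N := by gcongr
      _ = r / 2 := by rw [hd]; field_simp
      _ < r := by linarith
  have hlin_du : |f (d * u) - f 0 - a * (d * u)| ≤ η * |a| / N * |d * u| := by
    simpa [mul_comm a] using hlin (d * u) (by simpa using hdu)
  have e : u - (f (d * u) - f 0) / (a * d) = -(f (d * u) - f 0 - a * (d * u)) / (a * d) := by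
    field_simp; ring
  rw [e, abs_div, abs_neg, abs_mul a d, abs_of_pos hd0, div_le_iff₀ (by positivity)]
  calc _ ≤ η * |a| / N * |d * u| := hlin_du
    _ = η * |a| / N * d * |u| := by rw [abs_mul, abs_of_pos hd0, mul_assoc]
    _ ≤ η * |a| / N * d * N := by gcongr
    _ = η * (|a| * d) := by field_simp

-- The remainder vanishes at `0`, so it is controlled by its derivative, and the latter is the error
-- of the linear approximation of `deriv σ` at `0`, rescaled.
lemma exists_rescale_near_sq {σ : ℝ → ℝ} (hσ : Differentiable ℝ σ) {a : ℝ} (ha : a ≠ 0)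
    (hσ' : HasDerivAt (deriv σ) a 0) (M : ℝ) {η : ℝ} (hη : 0 < η) :
    ∃ c₀ c₁ c₂ d : ℝ, ∀ u, |u| ≤ M → |u ^ 2 - (c₀ + c₁ * u + c₂ * σ (d * u))| ≤ η ∧
      |deriv (fun u => u ^ 2 - (c₀ + c₁ * u + c₂ * σ (d * u))) u| ≤ η := by
  set N := max M 1
  have hMN : M ≤ N := le_max_left _ _
  have hN : 0 < N := by positivity
  obtain ⟨d, hd, hlin⟩ := exists_rescale_near_id ha hσ' N (show 0 < η / (2 * N) by positivity)
  set c := 2 / (a * d ^ 2) with hc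
  set R : ℝ → ℝ := fun u => u ^ 2 - (-c * σ 0 + -(c * d * deriv σ 0) * u + c * σ (d * u)) with hR
  have hR' : ∀ u, HasDerivAt R (2 * (u - (deriv σ (d * u) - deriv σ 0) / (a * d))) u := fun u => by
    have hσd := (hσ (d * u)).hasDerivAt.scomp u ((hasDerivAt_id u).const_mul d)
    refine ((hasDerivAt_pow 2 u).sub ((((hasDerivAt_id u).const_mul _).const_add _).add
      (hσd.const_mul c))).congr_deriv ?_
    simp only [hc, smul_eq_mul]
    field_simp
    ring
  have hbound : ∀ u, |u| ≤ N → ‖deriv R u‖ ≤ η / N := fun u hu => by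
    rw [(hR' u).deriv, norm_mul, Real.norm_two, Real.norm_eq_abs]
    calc _ ≤ 2 * (η / (2 * N)) := by gcongr; exact hlin u hu
      _ = η / N := by field_simp
  refine ⟨_, _, c, d, fun u hu => ⟨?_, (hbound u (hu.trans hMN)).trans
    (div_le_self hη.le (le_max_right _ _))⟩⟩
  have hmvt := (convex_closedBall (0 : ℝ) N).norm_image_sub_le_of_norm_deriv_le
    (fun s _ => (hR' s).differentiableAt) (fun s hs => hbound s (by simpa using hs))
    (x := 0) (y := u) (by simpa using hN.le) (mem_closedBall_zero_iff.2 (hu.trans hMN))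
  have hR0 : R 0 = 0 := by simp [hR]
  rw [hR0, sub_zero, sub_zero, Real.norm_eq_abs, Real.norm_eq_abs] at hmvt
  calc |R u| ≤ η / N * |u| := hmvt
    _ ≤ η / N * N := by gcongr; exact hu.trans hMN
    _ = η := by field_simp

/-! ### A bump built from `gelu` -/

lemma isBigO_gelu_sub_max :
    (fun t => gelu t - max t 0) =O[cocompact ℝ] (·⁻¹ : ℝ → ℝ) :=
  Asymptotics.IsBigO.of_bound 1 (Eventually.of_forall fun t => by
    simpa using abs_gelu_sub_max_le t)

lemma isBigO_inv_add_const (c : ℝ) :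
    (fun t => (t + c)⁻¹) =O[cocompact ℝ] (·⁻¹ : ℝ → ℝ) := by
  have h : Asymptotics.IsEquivalent (cocompact ℝ) (fun t : ℝ => t + c) id := by
    refine Asymptotics.IsEquivalent.refl.add_isLittleO ?_
    rw [← Metric.cobounded_eq_cocompact]
    exact Asymptotics.isLittleO_const_id_cobounded c
  exact h.inv.isBigO

/-- A second difference of `gelu`. Since `gelu` is asymptotic to `max · 0`, this is a bump which
vanishes at infinity, and it is computed by a GELU network with a single hidden layer. -/
noncomputable def geluBump (t : ℝ) : ℝ := gelu (t + 1) - 2 * gelu t + gelu (t + -1)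

lemma contDiff_geluBump : ContDiff ℝ 1 geluBump := by
  have := contDiff_gelu
  unfold geluBump
  fun_prop

lemma geluBump_zero_pos : 0 < geluBump 0 := by
  have hcdf := strictMono_cdf_gaussianReal 0 one_ne_zero (show (-1 : ℝ) < 1 by norm_num)
  have e : geluBump 0 = cdf (gaussianReal 0 1) 1 - cdf (gaussianReal 0 1) (-1) := by
    simp only [geluBump, gelu]; ring_nf
  rw [e]
  exact sub_pos.2 hcdf

lemma isBigO_geluBump : geluBump =O[cocompact ℝ] (·⁻¹ : ℝ → ℝ) := by
  have hshift : ∀ c, (fun t => gelu (t + c) - max (t + c) 0) =O[cocompact ℝ] (·⁻¹ : ℝ → ℝ) :=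
    fun c => (isBigO_gelu_sub_max.comp_tendsto
      (Homeomorph.addRight c).isClosedEmbedding.tendsto_cocompact).trans (isBigO_inv_add_const c)
  refine (((hshift 1).sub (isBigO_gelu_sub_max.const_mul_left 2)).add (hshift (-1))).congr' ?_ .rfl
  have hmax : ∀ t : ℝ, 1 ≤ |t| → max (t + 1) 0 - 2 * max t 0 + max (t + -1) 0 = 0 := fun t ht => by
    rcases le_abs.1 ht with h | h
    · rw [max_eq_left, max_eq_left, max_eq_left] <;> linarith
    · rw [max_eq_right, max_eq_right, max_eq_right] <;> linarith
  filter_upwards [tendsto_norm_cocompact_atTop.eventually_ge_atTop 1] with t ht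
  rw [geluBump]
  linarith [hmax t ht]

lemma tendsto_geluBump_cocompact : Tendsto geluBump (cocompact ℝ) (𝓝 0) := by
  refine isBigO_geluBump.trans_tendsto ?_
  rw [← Metric.cobounded_eq_cocompact]
  exact tendsto_inv₀_cobounded

lemma integrable_geluBump_sq : Integrable fun t => geluBump t ^ 2 := by
  have hdecay : (fun t => geluBump t ^ 2) =O[cocompact ℝ] fun t => (1 + t ^ 2)⁻¹ := by
    refine (isBigO_geluBump.pow 2).trans (Asymptotics.IsBigO.of_bound 2 ?_)
    filter_upwards [tendsto_norm_cocompact_atTop.eventually_ge_atTop 1] with t ht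
    have ht2 : 1 ≤ t ^ 2 := (one_le_sq_iff_one_le_abs t).2 ht
    rw [norm_pow, norm_inv, norm_inv, Real.norm_eq_abs, Real.norm_eq_abs, inv_pow, sq_abs,
      abs_of_pos (by positivity), ← div_eq_mul_inv, inv_le_comm₀ (by positivity) (by positivity),
      inv_div]
    linarith
  exact (contDiff_geluBump.continuous.pow 2).locallyIntegrable.integrable_of_isBigO_cocompact
    hdecay (integrable_inv_one_add_sq.integrableAtFilter _)

lemma tendsto_prod_cocompact_zero {ι : Type*} [Fintype ι] {X : ι → Type*}
    [∀ i, TopologicalSpace (X i)] {f : ∀ i, X i → ℝ} {C : ℝ} (hC : ∀ i x, |f i x| ≤ C)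
    (hf : ∀ i, Tendsto (f i) (cocompact _) (𝓝 0)) :
    Tendsto (fun x : ∀ i, X i => ∏ i, f i (x i)) (cocompact _) (𝓝 0) := by
  classical
  rw [← coprodᵢ_cocompact, Filter.coprodᵢ, tendsto_iSup]
  intro i
  have hsplit : (fun x : ∀ i, X i => ∏ i, f i (x i)) =
      fun x => f i (x i) * ∏ j ∈ Finset.univ.erase i, f j (x j) :=
    funext fun x => (Finset.mul_prod_erase _ _ (Finset.mem_univ i)).symm
  rw [hsplit]
  refine ((hf i).comp tendsto_comap).zero_mul_isBoundedUnder_le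
    ⟨C ^ (Finset.univ.erase i).card, eventually_map.2 (Eventually.of_forall fun x => ?_)⟩
  rw [Function.comp_apply, Real.norm_eq_abs, Finset.abs_prod, ← Finset.prod_const]
  exact Finset.prod_le_prod (fun j _ => abs_nonneg _) fun j _ => hC j _

/-- `ℝ^d` with the Euclidean norm. -/
abbrev Euc (d : ℕ) : Type := EuclideanSpace ℝ (Fin d)

/-- A bump on `ℝ^d`, with squares to make it nonnegative. It serves as a kernel for smoothing in
`y` and, its translates and dilates separating points, as a generator of functions of `x`. -/
noncomputable def prodBump {d : ℕ} (z : Euc d) : ℝ := ∏ i, geluBump (z i) ^ 2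

section ProdBump

variable {d : ℕ}

lemma contDiff_prodBump : ContDiff ℝ 1 (prodBump (d := d)) :=
  contDiff_prod fun i _ => (contDiff_geluBump.comp (by fun_prop)).pow 2

lemma prodBump_nonneg (z : Euc d) : 0 ≤ prodBump z := Finset.prod_nonneg fun _ _ => sq_nonneg _

lemma prodBump_zero_pos : 0 < prodBump (0 : Euc d) :=
  Finset.prod_pos fun _ _ => pow_pos geluBump_zero_pos 2

lemma tendsto_prodBump_cocompact : Tendsto (prodBump (d := d)) (cocompact _) (𝓝 0) := by
  have hlim : Tendsto (fun t => geluBump t ^ 2) (cocompact ℝ) (𝓝 0) := by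
    simpa using tendsto_geluBump_cocompact.pow 2
  let f : ZeroAtInftyContinuousMap ℝ ℝ := ⟨⟨_, contDiff_geluBump.continuous.pow 2⟩, hlim⟩
  exact (tendsto_prod_cocompact_zero (ι := Fin d) (fun _ => f.toBCF.norm_coe_le_norm)
    fun _ => hlim).comp
    (EuclideanSpace.equiv (Fin d) ℝ).toHomeomorph.isClosedEmbedding.tendsto_cocompact

lemma integrable_prodBump : Integrable (prodBump (d := d)) := by
  have h : Integrable fun z : Fin d → ℝ => ∏ i, geluBump (z i) ^ 2 :=
    Integrable.fintype_prod (f := fun _ t => geluBump t ^ 2) fun _ => integrable_geluBump_sq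
  exact ((EuclideanSpace.volume_preserving_symm_measurableEquiv_toLp (Fin d)).integrable_comp_emb
    (MeasurableEquiv.measurableEmbedding _)).2 h

lemma integral_prodBump_pos : 0 < ∫ z, prodBump (d := d) z :=
  integral_pos_of_integrable_nonneg_nonzero (x := 0) contDiff_prodBump.continuous
    integrable_prodBump prodBump_nonneg prodBump_zero_pos.ne'

end ProdBump

/-! ### Functions computed by networks -/

namespace DenseNet

variable {n m k : ℕ}

/-- Precomposition of a network with the affine map `a ↦ V a + c`. -/
def affineComp (V : Matrix (Fin k) (Fin m) ℝ) (c : Fin k → ℝ) : DenseNet n k → DenseNet n m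
  | output W b => output (W * V) (W *ᵥ c + b)
  | hidden W b N => hidden (W * V) (W *ᵥ c + b) N

lemma depth_affineComp (V : Matrix (Fin k) (Fin m) ℝ) (c : Fin k → ℝ) (N : DenseNet n k) :
    (N.affineComp V c).depth = N.depth := by
  cases N <;> rfl

lemma eval_affineComp (σ : ℝ → ℝ) (V : Matrix (Fin k) (Fin m) ℝ) (c : Fin k → ℝ)
    (N : DenseNet n k) (a : Fin m → ℝ) :
    (N.affineComp V c).eval σ a = N.eval σ (V *ᵥ a + c) := by
  cases N <;> simp [affineComp, eval, Matrix.mulVec_add, add_assoc]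

/-- The network that runs `N` on the output of `M`: the output layer of `M` is merged into the
first layer of `N`, so the hidden layers are those of `M` followed by those of `N`. -/
def andThen : {m : ℕ} → DenseNet k m → DenseNet n k → DenseNet n m
  | _, output W b, N => N.affineComp W b
  | _, hidden W b M, N => hidden W b (M.andThen N)

lemma depth_andThen (M : DenseNet k m) (N : DenseNet n k) :
    (M.andThen N).depth = M.depth + N.depth := by
  induction M with
  | output W b => simp [andThen, depth, depth_affineComp]
  | hidden W b M ih => simp [andThen, depth, ih]; ring

lemma eval_andThen (σ : ℝ → ℝ) (M : DenseNet k m) (N : DenseNet n k) (a : Fin m → ℝ) :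
    (M.andThen N).eval σ a = N.eval σ (M.eval σ a) := by
  induction M with
  | output W b => simp [andThen, eval, eval_affineComp]
  | hidden W b M ih => simp [andThen, eval, ih]

variable {α : Type*} {σ : ℝ → ℝ} {inp : α → Fin m → ℝ}

/-- The affine combinations of the outputs of the network `θ`, as functions of a parameter `a` on
which the input `inp a` depends: what an additional output layer can compute. -/
def readouts (σ : ℝ → ℝ) (inp : α → Fin m → ℝ) (θ : DenseNet n m) : Submodule ℝ (α → ℝ) :=
  Submodule.span ℝ (insert 1 (Set.range fun i a => θ.eval σ (inp a) i))

lemma one_mem_readouts (θ : DenseNet n m) : (1 : α → ℝ) ∈ θ.readouts σ inp :=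
  Submodule.subset_span (Set.mem_insert _ _)

lemma eval_mem_readouts (θ : DenseNet n m) (i : Fin n) :
    (fun a => θ.eval σ (inp a) i) ∈ θ.readouts σ inp :=
  Submodule.subset_span (Set.mem_insert_of_mem _ ⟨i, rfl⟩)

lemma exists_eq_of_mem_readouts {θ : DenseNet n m} {f : α → ℝ} (hf : f ∈ θ.readouts σ inp) :
    ∃ (w : Fin n → ℝ) (c : ℝ), ∀ a, f a = w ⬝ᵥ θ.eval σ (inp a) + c := by
  obtain ⟨c, g, hg, rfl⟩ := Submodule.mem_span_insert.1 hf
  obtain ⟨w, rfl⟩ := (Submodule.mem_span_range_iff_exists_fun ℝ).1 hg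
  exact ⟨w, c, fun a => by simp [dotProduct, add_comm]⟩

lemma exists_eval_eq_of_mem_readouts {θ : DenseNet n m} {f : Fin k → α → ℝ}
    (hf : ∀ i, f i ∈ θ.readouts σ inp) :
    ∃ θ' : DenseNet k m, θ'.depth = θ.depth ∧ ∀ a i, θ'.eval σ (inp a) i = f i a := by
  choose w c hf using fun i => exists_eq_of_mem_readouts (hf i)
  exact ⟨θ.andThen (.output (Matrix.of w) c), by simp [depth_andThen, depth],
    fun a i => by simp [eval_andThen, eval, hf, Matrix.mulVec]⟩

lemma exists_depth_succ_comp_mem_readouts {κ : Type*} [Finite κ] {θ : DenseNet n m}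
    {v : κ → α → ℝ} (hv : ∀ i, v i ∈ θ.readouts σ inp) :
    ∃ (k : ℕ) (θ' : DenseNet k m), θ'.depth = θ.depth + 1 ∧
      ∀ i, (fun a => σ (v i a)) ∈ θ'.readouts σ inp := by
  obtain ⟨r, ⟨e⟩⟩ := Finite.exists_equiv_fin κ
  obtain ⟨M, hM, hMv⟩ := exists_eval_eq_of_mem_readouts fun i => hv (e.symm i)
  let N : DenseNet r r := .hidden (1 : Matrix (Fin r) _ ℝ) 0 (.output 1 0)
  refine ⟨_, M.andThen N, by simp [N, depth_andThen, depth, hM], fun i => ?_⟩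
  convert eval_mem_readouts (M.andThen N) (e i) using 2 with a
  simp [N, eval_andThen, eval, hMv]

-- The extra layer also applies `σ` to `±` each output of `θ`, and `σ t - σ (-t) = t` recovers it.
lemma exists_depth_succ_readouts_ge (hσ : ∀ t, σ t - σ (-t) = t) {θ : DenseNet n m} {f : α → ℝ}
    (hf : f ∈ θ.readouts σ inp) :
    ∃ (k : ℕ) (θ' : DenseNet k m), θ'.depth = θ.depth + 1 ∧
      θ.readouts σ inp ≤ θ'.readouts σ inp ∧ (fun a => σ (f a)) ∈ θ'.readouts σ inp := by
  let out (i : Fin n) (a : α) : ℝ := θ.eval σ (inp a) i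
  obtain ⟨k, θ', hdepth, hmem⟩ := exists_depth_succ_comp_mem_readouts
    (v := Sum.elim (Sum.elim out (-out)) fun _ : Unit => f) (θ := θ) (σ := σ) (inp := inp) (by
      rintro ((i | i) | _)
      exacts [eval_mem_readouts θ i, neg_mem (eval_mem_readouts θ i), hf])
  refine ⟨k, θ', hdepth, Submodule.span_le.2 (Set.insert_subset (one_mem_readouts θ') ?_),
    hmem (.inr ())⟩
  rintro _ ⟨i, rfl⟩
  have hout : (fun a => σ (out i a)) - (fun a => σ (-out i a)) = out i := funext fun a => hσ _
  change out i ∈ θ'.readouts σ inp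
  exact hout ▸ sub_mem (hmem (.inl (.inl i))) (hmem (.inl (.inr i)))

end DenseNet

/-- The functions of `a` obtained from the coordinates of `inp a` and constants by linear
combinations and applications of `σ`, without any bookkeeping of layers. -/
inductive IsNet (σ : ℝ → ℝ) {α ι : Type*} (inp : α → ι → ℝ) : (α → ℝ) → Prop
  | const (c : ℝ) : IsNet σ inp fun _ => c
  | input (i : ι) : IsNet σ inp fun a => inp a i
  | add {f g : α → ℝ} : IsNet σ inp f → IsNet σ inp g → IsNet σ inp fun a => f a + g a
  | smul (c : ℝ) {f : α → ℝ} : IsNet σ inp f → IsNet σ inp fun a => c * f a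
  | activation {f : α → ℝ} : IsNet σ inp f → IsNet σ inp fun a => σ (f a)

section Realization

variable {α : Type*} {m n : ℕ} {σ : ℝ → ℝ} {inp : α → Fin m → ℝ}

lemma IsNet.exists_mem_readouts (hσ : ∀ t, σ t - σ (-t) = t) {f : α → ℝ} (hf : IsNet σ inp f)
    (θ : DenseNet n m) (hθ : ∀ i, (fun a => inp a i) ∈ θ.readouts σ inp) :
    ∃ (k : ℕ) (θ' : DenseNet k m), θ.readouts σ inp ≤ θ'.readouts σ inp ∧
      f ∈ θ'.readouts σ inp := by
  induction hf generalizing n with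
  | const c =>
    refine ⟨n, θ, le_rfl, ?_⟩
    convert Submodule.smul_mem _ c θ.one_mem_readouts using 1
    simp [funext_iff]
  | input i => exact ⟨n, θ, le_rfl, hθ i⟩
  | add _ _ ihf ihg =>
    obtain ⟨k, θ₁, hle₁, hf₁⟩ := ihf θ hθ
    obtain ⟨l, θ₂, hle₂, hg₂⟩ := ihg θ₁ fun i => hle₁ (hθ i)
    exact ⟨l, θ₂, hle₁.trans hle₂, add_mem (hle₂ hf₁) hg₂⟩
  | smul c _ ih =>
    obtain ⟨k, θ₁, hle, hf⟩ := ih θ hθ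
    exact ⟨k, θ₁, hle, Submodule.smul_mem _ c hf⟩
  | activation _ ih =>
    obtain ⟨k, θ₁, hle₁, hf₁⟩ := ih θ hθ
    obtain ⟨l, θ₂, -, hle₂, hσf⟩ := DenseNet.exists_depth_succ_readouts_ge hσ hf₁
    exact ⟨l, θ₂, hle₁.trans hle₂, hσf⟩

lemma exists_mem_readouts_of_forall_isNet (hσ : ∀ t, σ t - σ (-t) = t) {κ : Type*}
    {f : κ → α → ℝ} (hf : ∀ i, IsNet σ inp (f i)) (s : Finset κ) :
    ∃ (k : ℕ) (θ : DenseNet k m), (∀ i, (fun a => inp a i) ∈ θ.readouts σ inp) ∧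
      ∀ i ∈ s, f i ∈ θ.readouts σ inp := by
  classical
  induction s using Finset.induction_on with
  | empty =>
    refine ⟨m, .output 1 0, fun i => ?_, by simp⟩
    convert DenseNet.eval_mem_readouts (.output 1 0) i using 2
    simp [DenseNet.eval]
  | insert i s _ ih =>
    obtain ⟨k, θ, hinp, hs⟩ := ih
    obtain ⟨l, θ', hle, hi⟩ := (hf i).exists_mem_readouts hσ θ hinp
    exact ⟨l, θ', fun i => hle (hinp i), Finset.forall_mem_insert _ _ _ |>.2
      ⟨hi, fun j hj => hle (hs j hj)⟩⟩

lemma exists_denseNet_of_forall_isNet (hσ : ∀ t, σ t - σ (-t) = t) {f : Fin n → α → ℝ}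
    (hf : ∀ i, IsNet σ inp (f i)) :
    ∃ θ : DenseNet n m, 0 < θ.depth ∧ ∀ a i, θ.eval σ (inp a) i = f i a := by
  obtain ⟨k, θ₀, -, hθ₀⟩ := exists_mem_readouts_of_forall_isNet hσ hf Finset.univ
  obtain ⟨l, θ₁, hdepth, hle, -⟩ := DenseNet.exists_depth_succ_readouts_ge hσ θ₀.one_mem_readouts
  obtain ⟨θ, hθ, heval⟩ := DenseNet.exists_eval_eq_of_mem_readouts
    fun i => hle (hθ₀ i (Finset.mem_univ i))
  exact ⟨θ, by omega, heval⟩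

end Realization

/-! ### First-order jets -/

section Jet

variable {d : ℕ} {E : Type*} [NormedAddCommGroup E] [NormedSpace ℝ E]

/-- The first-order jet of `k` at `y`: the value at the index `none` and the `j`-th partial
derivative at the index `some j`. In the sup norm on jets, approximation is approximation of the
value and of the derivative at once. -/
noncomputable def jet (k : Euc d → E) (y : Euc d) : Option (Fin d) → E
  | none => k y
  | some j => fderiv ℝ k y (EuclideanSpace.single j 1)

/-- The product of jets, given by the Leibniz rule. -/
def jetMul {ι : Type*} (a : Option ι → ℝ) (v : Option ι → E) : Option ι → E
  | none => a none • v none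
  | some j => a none • v (some j) + a (some j) • v none

lemma jet_congr {k l : Euc d → E} {y : Euc d} (h : k =ᶠ[𝓝 y] l) : jet k y = jet l y := by
  ext (_ | j)
  · exact h.eq_of_nhds
  · simp only [jet, h.fderiv_eq]

lemma norm_jet_const_le (c : E) (y : Euc d) : ‖jet (fun _ => c) y‖ ≤ ‖c‖ := by
  refine (pi_norm_le_iff_of_nonneg (norm_nonneg c)).2 ?_
  rintro (_ | j) <;> simp [jet]

lemma jet_comp_sub (k : Euc d → E) (z y : Euc d) : jet (fun y => k (y - z)) y = jet k (y - z) := by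
  ext (_ | j)
  · rfl
  · simp only [jet, fderiv_comp_sub]

lemma jet_add {k l : Euc d → E} {y : Euc d} (hk : DifferentiableAt ℝ k y)
    (hl : DifferentiableAt ℝ l y) : jet (fun y => k y + l y) y = jet k y + jet l y := by
  ext (_ | j)
  · rfl
  · simp [jet, fderiv_fun_add hk hl]

lemma jet_sub {k l : Euc d → E} {y : Euc d} (hk : DifferentiableAt ℝ k y)
    (hl : DifferentiableAt ℝ l y) : jet (fun y => k y - l y) y = jet k y - jet l y := by
  ext (_ | j)
  · rfl
  · simp [jet, fderiv_fun_sub hk hl]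

lemma jet_smul {a : Euc d → ℝ} {k : Euc d → E} {y : Euc d} (ha : DifferentiableAt ℝ a y)
    (hk : DifferentiableAt ℝ k y) : jet (fun y => a y • k y) y = jetMul (jet a y) (jet k y) := by
  ext (_ | j)
  · rfl
  · simp [jet, jetMul, fderiv_fun_smul ha hk]

lemma jet_const_smul {k : Euc d → E} {y : Euc d} (hk : DifferentiableAt ℝ k y) (c : ℝ) :
    jet (fun y => c • k y) y = c • jet k y := by
  ext (_ | j)
  · rfl
  · simp [jet, fderiv_fun_const_smul hk]

lemma jet_sq {k : Euc d → ℝ} {y : Euc d} (hk : DifferentiableAt ℝ k y) :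
    jet (fun y => k y ^ 2) y = jetMul (jet k y) (jet k y) := by
  simpa only [sq, smul_eq_mul] using jet_smul hk hk

lemma jet_sq_sub_jet_sq {k l : Euc d → ℝ} {y : Euc d} (hk : DifferentiableAt ℝ k y)
    (hl : DifferentiableAt ℝ l y) : jet (fun y => k y ^ 2) y - jet (fun y => l y ^ 2) y =
      jetMul (jet k y - jet l y) (jet k y + jet l y) := by
  rw [← jet_sub (hk.fun_pow 2) (hl.fun_pow 2), ← jet_sub hk hl, ← jet_add hk hl,
    ← jet_smul (hk.fun_sub hl) (hk.fun_add hl)]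
  congr 1
  ext y
  rw [smul_eq_mul]
  ring

lemma norm_jetMul_le {ι : Type*} [Fintype ι] (a : Option ι → ℝ) (v : Option ι → E) :
    ‖jetMul a v‖ ≤ 2 * ‖a‖ * ‖v‖ := by
  have hle : ∀ i j, ‖a i • v j‖ ≤ ‖a‖ * ‖v‖ := fun i j => by
    rw [norm_smul]
    gcongr
    exacts [norm_le_pi_norm a i, norm_le_pi_norm v j]
  refine (pi_norm_le_iff_of_nonneg (by positivity)).2 ?_
  rintro (_ | j)
  · exact (hle none none).trans (by nlinarith [norm_nonneg a, norm_nonneg v])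
  · refine (norm_add_le _ _).trans ?_
    linarith [hle none (some j), hle (some j) none]

lemma norm_jet_comp_le {s : ℝ → ℝ} {k : Euc d → ℝ} {y : Euc d} (hs : DifferentiableAt ℝ s (k y))
    (hk : DifferentiableAt ℝ k y) :
    ‖jet (fun y => s (k y)) y‖ ≤ max |s (k y)| (|deriv s (k y)| * ‖jet k y‖) := by
  refine (pi_norm_le_iff_of_nonneg (by positivity)).2 ?_
  rintro (_ | j)
  · exact le_max_left _ _
  · refine le_max_of_le_right ?_
    have hcomp := (hs.hasDerivAt.comp_hasFDerivAt y hk.hasFDerivAt).fderiv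
    rw [Function.comp_def] at hcomp
    simp only [jet, hcomp, smul_apply, smul_eq_mul, norm_mul, Real.norm_eq_abs]
    gcongr
    exact norm_le_pi_norm (jet k y) (some j)

lemma continuous_jet_uncurry {X : Type*} [NormedAddCommGroup X] [NormedSpace ℝ X]
    {f : X → Euc d → E} (hf : ContDiff ℝ 1 (Function.uncurry f)) :
    Continuous fun z : X × Euc d => jet (f z.1) z.2 := by
  have hderiv : ContDiff ℝ 0 fun z : X × Euc d => fderiv ℝ (f z.1) z.2 :=
    ContDiff.fderiv (f := fun z : X × Euc d => f z.1)
      (hf.comp ((contDiff_fst.comp contDiff_fst).prodMk contDiff_snd)) contDiff_snd le_rfl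
  refine continuous_pi ?_
  rintro (_ | j)
  · exact hf.continuous
  · exact hderiv.continuous.clm_apply continuous_const

lemma continuous_jet {k : Euc d → E} (hk : ContDiff ℝ 1 k) : Continuous (jet k) :=
  (continuous_jet_uncurry (f := fun _ : ℝ => k) (hk.comp contDiff_snd)).comp
    (Continuous.prodMk_right 0)

end Jet

/-! ### Uniform limits of networks -/

section NetApprox

variable {dx dy : ℕ}

/-- The concatenation of `x` and `y`. -/
def netInput (z : Euc dx × Euc dy) : Fin (dx + dy) → ℝ :=
  Fin.append (fun i => z.1 i) fun j => z.2 j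

/-- The real functions of `x` and `y` computed by GELU networks. -/
def IsGeluNet (n : Euc dx → Euc dy → ℝ) : Prop := IsNet gelu netInput (Function.uncurry n)

namespace IsGeluNet

variable {n m : Euc dx → Euc dy → ℝ}

lemma const (c : ℝ) : IsGeluNet fun (_ : Euc dx) (_ : Euc dy) => c := IsNet.const c

lemma fst (i : Fin dx) : IsGeluNet fun (x : Euc dx) (_ : Euc dy) => x i := by
  have h := IsNet.input (σ := gelu) (inp := netInput (dx := dx) (dy := dy)) (Fin.castAdd dy i)
  simp only [netInput, Fin.append_left] at h
  exact h

lemma snd (j : Fin dy) : IsGeluNet fun (_ : Euc dx) (y : Euc dy) => y j := by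
  have h := IsNet.input (σ := gelu) (inp := netInput (dx := dx) (dy := dy)) (Fin.natAdd dx j)
  simp only [netInput, Fin.append_right] at h
  exact h

lemma add (hn : IsGeluNet n) (hm : IsGeluNet m) : IsGeluNet fun x y => n x y + m x y :=
  IsNet.add hn hm

lemma const_mul (c : ℝ) (hn : IsGeluNet n) : IsGeluNet fun x y => c * n x y := IsNet.smul c hn

lemma gelu (hn : IsGeluNet n) : IsGeluNet fun x y => gelu (n x y) := IsNet.activation hn

lemma geluBump (hn : IsGeluNet n) : IsGeluNet fun x y => geluBump (n x y) := by
  have h := ((hn.add (.const 1)).gelu.add (hn.gelu.const_mul (-2))).add (hn.add (.const (-1))).gelu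
  simpa only [_root_.geluBump, neg_mul, ← sub_eq_add_neg] using h

lemma contDiff (hn : IsGeluNet n) : ContDiff ℝ 1 (Function.uncurry n) := by
  rw [IsGeluNet] at hn
  generalize Function.uncurry n = f at hn ⊢
  induction hn with
  | const c => fun_prop
  | input i =>
    refine Fin.addCases (fun i => ?_) (fun j => ?_) i
    · simp only [netInput, Fin.append_left]; fun_prop
    · simp only [netInput, Fin.append_right]; fun_prop
  | add _ _ h1 h2 => exact h1.add h2
  | smul c _ h => exact contDiff_const.mul h
  | activation _ h => exact contDiff_gelu.comp h

lemma differentiable (hn : IsGeluNet n) (x : Euc dx) : Differentiable ℝ (n x) :=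
  (hn.contDiff.comp (contDiff_prodMk_right x)).differentiable one_ne_zero

lemma exists_jet_near_sq {K : Set (Euc dy)} (hn : IsGeluNet n) {M : ℝ}
    (hM : ∀ x, ∀ y ∈ K, ‖jet (n x) y‖ ≤ M) {ε : ℝ} (hε : 0 < ε) :
    ∃ m : Euc dx → Euc dy → ℝ, IsGeluNet m ∧
      ∀ x, ∀ y ∈ K, ‖jet (fun y => n x y ^ 2) y - jet (m x) y‖ ≤ ε := by
  have hgelu : Differentiable ℝ _root_.gelu := contDiff_gelu.differentiable one_ne_zero
  obtain ⟨c₀, c₁, c₂, d, hR⟩ := exists_rescale_near_sq hgelu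
    (mul_pos two_pos (gaussianPDFReal_pos 0 1 0 one_ne_zero)).ne' hasDerivAt_deriv_gelu_zero M
    (show 0 < ε / max M 1 by positivity)
  have hm := ((const c₀).add (hn.const_mul c₁)).add ((hn.const_mul d).gelu.const_mul c₂)
  refine ⟨_, hm, fun x y hy => ?_⟩
  obtain ⟨hval, hderiv⟩ := hR (n x y) ((norm_le_pi_norm (jet (n x) y) none).trans (hM x y hy))
  rw [← jet_sub ((hn.differentiable x y).fun_pow 2) (hm.differentiable x y)]
  have hRd : Differentiable ℝ fun u => u ^ 2 - (c₀ + c₁ * u + c₂ * _root_.gelu (d * u)) := by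
    fun_prop
  refine (norm_jet_comp_le (hRd (n x y)) (hn.differentiable x y)).trans (max_le ?_ ?_)
  · exact hval.trans (div_le_self hε.le (le_max_right _ _))
  · calc _ ≤ ε / max M 1 * max M 1 := by
          gcongr; exact (hM x y hy).trans (le_max_left _ _)
      _ = ε := div_mul_cancel₀ _ (by positivity)

end IsGeluNet

/-- `f` and its derivative in `y` are bounded over `y ∈ K` and, uniformly in `x` and `y ∈ K`, limits
of functions computed by GELU networks and of their derivatives in `y`. -/
structure NetApprox (K : Set (Euc dy)) (f : Euc dx → Euc dy → ℝ) : Prop where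
  differentiable : ∀ x, Differentiable ℝ (f x)
  bounded : ∃ M, ∀ x, ∀ y ∈ K, ‖jet (f x) y‖ ≤ M
  approx : ∀ ε > 0, ∃ n : Euc dx → Euc dy → ℝ, IsGeluNet n ∧
    ∀ x, ∀ y ∈ K, ‖jet (f x) y - jet (n x) y‖ ≤ ε

variable {K : Set (Euc dy)} {f g : Euc dx → Euc dy → ℝ}

lemma IsGeluNet.netApprox (hf : IsGeluNet f) {M : ℝ} (hM : ∀ x, ∀ y ∈ K, ‖jet (f x) y‖ ≤ M) :
    NetApprox K f :=
  ⟨hf.differentiable, ⟨M, hM⟩, fun ε hε => ⟨f, hf, fun x y _ => by simpa using hε.le⟩⟩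

namespace NetApprox

lemma const (c : ℝ) : NetApprox K fun (_ : Euc dx) (_ : Euc dy) => c :=
  (IsGeluNet.const c).netApprox fun _ _ _ => norm_jet_const_le c _

lemma add (hf : NetApprox K f) (hg : NetApprox K g) : NetApprox K fun x y => f x y + g x y := by
  obtain ⟨M, hM⟩ := hf.bounded
  obtain ⟨M', hM'⟩ := hg.bounded
  refine ⟨fun x => (hf.differentiable x).add (hg.differentiable x), ⟨M + M', fun x y hy => ?_⟩,
    fun ε hε => ?_⟩
  · rw [jet_add (hf.differentiable x y) (hg.differentiable x y)]
    exact (norm_add_le _ _).trans (add_le_add (hM x y hy) (hM' x y hy))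
  · obtain ⟨n, hn, hfn⟩ := hf.approx (ε / 2) (half_pos hε)
    obtain ⟨m, hm, hgm⟩ := hg.approx (ε / 2) (half_pos hε)
    refine ⟨_, hn.add hm, fun x y hy => ?_⟩
    rw [jet_add (hf.differentiable x y) (hg.differentiable x y),
      jet_add (hn.differentiable x y) (hm.differentiable x y), add_sub_add_comm, ← add_halves ε]
    exact (norm_add_le _ _).trans (add_le_add (hfn x y hy) (hgm x y hy))

lemma const_mul (c : ℝ) (hf : NetApprox K f) : NetApprox K fun x y => c * f x y := by
  obtain ⟨M, hM⟩ := hf.bounded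
  refine ⟨fun x => (hf.differentiable x).const_mul c, ⟨‖c‖ * M, fun x y hy => ?_⟩,
    fun ε hε => ?_⟩
  · rw [← funext fun y => smul_eq_mul c (f x y), jet_const_smul (hf.differentiable x y), norm_smul]
    gcongr
    exact hM x y hy
  · obtain ⟨n, hn, hfn⟩ := hf.approx (ε / (‖c‖ + 1)) (by positivity)
    refine ⟨_, hn.const_mul c, fun x y hy => ?_⟩
    simp only [← smul_eq_mul (a := c)]
    rw [jet_const_smul (hf.differentiable x y), jet_const_smul (hn.differentiable x y), ← smul_sub,
      norm_smul]
    calc _ ≤ (‖c‖ + 1) * (ε / (‖c‖ + 1)) := by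
          gcongr
          exacts [le_add_of_nonneg_right zero_le_one, hfn x y hy]
      _ = ε := by field_simp

-- `f ^ 2 - n ^ 2 = (f - n) * (f + n)` reduces the square of `f` to that of a nearby network `n`.
lemma sq (hf : NetApprox K f) : NetApprox K fun x y => f x y ^ 2 := by
  obtain ⟨M, hM⟩ := hf.bounded
  refine ⟨fun x => (hf.differentiable x).pow 2, ⟨2 * M * M, fun x y hy => ?_⟩, fun ε hε => ?_⟩
  · rw [jet_sq (hf.differentiable x y)]
    have hM0 := (norm_nonneg _).trans (hM x y hy)
    refine (norm_jetMul_le _ _).trans ?_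
    gcongr <;> exact hM x y hy
  · set δ := min 1 (ε / (4 * (2 * |M| + 1)))
    have hδε : 2 * δ * (2 * |M| + 1) ≤ ε / 2 := by
      have := (le_div_iff₀ (by positivity)).1 (min_le_right 1 (ε / (4 * (2 * |M| + 1))))
      linarith
    obtain ⟨n, hn, hfn⟩ := hf.approx δ (by positivity)
    have hnM : ∀ x, ∀ y ∈ K, ‖jet (n x) y‖ ≤ |M| + 1 := fun x y hy => by
      have := norm_le_norm_add_norm_sub (jet (f x) y) (jet (n x) y)
      linarith [hfn x y hy, hM x y hy, le_abs_self M, min_le_left 1 (ε / (4 * (2 * |M| + 1)))]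
    obtain ⟨m, hm, hnm⟩ := hn.exists_jet_near_sq hnM (half_pos hε)
    refine ⟨m, hm, fun x y hy => ?_⟩
    rw [← sub_add_sub_cancel _ (jet (fun y => n x y ^ 2) y),
      jet_sq_sub_jet_sq (hf.differentiable x y) (hn.differentiable x y), ← add_halves ε]
    refine (norm_add_le _ _).trans (add_le_add ?_ (hnm x y hy))
    refine ((norm_jetMul_le _ _).trans ?_).trans hδε
    gcongr
    · exact hfn x y hy
    · linarith [norm_add_le (jet (f x) y) (jet (n x) y), hM x y hy, hnM x y hy, le_abs_self M]

lemma mul (hf : NetApprox K f) (hg : NetApprox K g) : NetApprox K fun x y => f x y * g x y := by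
  convert ((hf.add hg).sq.const_mul (1 / 4)).add
    ((hf.add (hg.const_mul (-1))).sq.const_mul (-(1 / 4))) using 3
  ring

lemma prod {ι : Type*} (s : Finset ι) {F : ι → Euc dx → Euc dy → ℝ}
    (hF : ∀ i ∈ s, NetApprox K (F i)) : NetApprox K fun x y => ∏ i ∈ s, F i x y := by
  classical
  induction s using Finset.induction_on with
  | empty => simpa using const 1
  | insert i s hi ih =>
    simp only [Finset.prod_insert hi]
    exact (hF i (Finset.mem_insert_self i s)).mul
      (ih fun j hj => hF j (Finset.mem_insert_of_mem hj))

end NetApprox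

lemma netApprox_prodBump_fst (c : ℝ) (a : Euc dx) :
    NetApprox K fun (x : Euc dx) (_ : Euc dy) => prodBump (c • (x - a)) := by
  let β : ZeroAtInftyContinuousMap ℝ ℝ :=
    ⟨⟨geluBump, contDiff_geluBump.continuous⟩, tendsto_geluBump_cocompact⟩
  refine NetApprox.prod _ fun i _ => NetApprox.sq ?_
  have hnet := (((IsGeluNet.fst (dy := dy) i).add (.const (-a i))).const_mul c).geluBump
  simp only [← sub_eq_add_neg] at hnet
  exact hnet.netApprox fun x y _ =>
    (norm_jet_const_le _ y).trans (β.toBCF.norm_coe_le_norm (c * (x i - a i)))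

lemma netApprox_prodBump_snd (hK : IsCompact K) (c : ℝ) (b : Euc dy) :
    NetApprox K fun (_ : Euc dx) (y : Euc dy) => prodBump (c • (y - b)) := by
  refine NetApprox.prod _ fun i _ => NetApprox.sq ?_
  have hnet := (((IsGeluNet.snd (dx := dx) i).add (.const (-b i))).const_mul c).geluBump
  simp only [← sub_eq_add_neg] at hnet
  obtain ⟨M, hM⟩ := hK.exists_bound_of_continuousOn
    ((continuous_jet_uncurry hnet.contDiff).comp
      (Continuous.prodMk_right (0 : Euc dx))).continuousOn
  exact hnet.netApprox fun _ y hy => hM y hy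

end NetApprox

/-! ### Density of network functions of `x` in `L^p` -/

section OnePointRestriction

variable {X : Type*} [TopologicalSpace X] [MeasurableSpace X] [BorelSpace X]
  (p : ℝ≥0∞) [Fact (1 ≤ p)] (μ : Measure X) [IsFiniteMeasure μ]

/-- The restriction of continuous functions on the one-point compactification of `X` to `X`, as a
map into `L^p`. The Stone–Weierstrass theorem applies on the compactification. -/
noncomputable def onePointToLp : C(OnePoint X, ℝ) →L[ℝ] Lp ℝ p μ :=
  (BoundedContinuousFunction.toLp p μ ℝ).comp <|
    (BoundedContinuousFunction.compContinuousCLM ℝ ℝ ⟨_, OnePoint.continuous_coe⟩).comp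
      (ContinuousMap.linearIsometryBoundedOfCompact (OnePoint X) ℝ ℝ
        ).toContinuousLinearEquiv.toContinuousLinearMap

variable {p μ}

lemma coeFn_onePointToLp (F : C(OnePoint X, ℝ)) :
    (onePointToLp p μ F : X → ℝ) =ᵐ[μ] fun x => F (x : OnePoint X) :=
  BoundedContinuousFunction.coeFn_toLp _ _ _ _

lemma denseRange_onePointToLp [NormalSpace X] [R1Space X] [WeaklyLocallyCompactSpace X] [μ.Regular]
    (hp : p ≠ ∞) : DenseRange (onePointToLp p μ) := by
  intro f
  refine EMetric.mem_closure_iff.2 fun ε hε => ?_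
  obtain ⟨δ, hδ, hδε⟩ := exists_between hε
  obtain ⟨g, hgsupp, hfg, hg, -⟩ := (Lp.memLp f).exists_hasCompactSupport_eLpNorm_sub_le hp hδ.ne'
  have hlim : Tendsto g (coclosedCompact X) (𝓝 0) := by
    rw [coclosedCompact_eq_cocompact]
    exact hgsupp.is_zero_at_infty
  refine ⟨_, ⟨OnePoint.continuousMapMk ⟨g, hg⟩ 0 hlim, rfl⟩, ?_⟩
  rw [Lp.edist_def, eLpNorm_congr_ae (EventuallyEq.rfl.sub (coeFn_onePointToLp _))]
  exact hfg.trans_lt hδε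

end OnePointRestriction

section Density

variable {dx dy : ℕ}

lemma tendsto_prodBump_smul_sub {c : ℝ} (hc : c ≠ 0) (a : Euc dx) :
    Tendsto (fun x => prodBump (c • (x - a))) (coclosedCompact _) (𝓝 0) := by
  rw [coclosedCompact_eq_cocompact]
  exact tendsto_prodBump_cocompact.comp
    ((Homeomorph.smulOfNeZero c hc).isClosedEmbedding.tendsto_cocompact.comp
      (Homeomorph.subRight a).isClosedEmbedding.tendsto_cocompact)

/-- The function `x ↦ prodBump (c • (x - a))` on the one-point compactification. -/
noncomputable def onePointBump {c : ℝ} (hc : c ≠ 0) (a : Euc dx) : C(OnePoint (Euc dx), ℝ) :=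
  OnePoint.continuousMapMk ⟨fun x => prodBump (c • (x - a)),
    contDiff_prodBump.continuous.comp (by fun_prop)⟩ 0 (tendsto_prodBump_smul_sub hc a)

lemma exists_onePointBump_ne_of_ne {a b : Euc dx} (hab : a ≠ b) :
    ∃ (c : ℝ) (hc : c ≠ 0), onePointBump hc a a ≠ onePointBump hc a b := by
  have hfar : Tendsto (fun c : ℝ => c • (b - a)) atTop (cocompact _) := by
    rw [← Metric.cobounded_eq_cocompact, ← tendsto_norm_atTop_iff_cobounded]
    simp only [norm_smul]
    exact tendsto_norm_atTop_atTop.atTop_mul_const (norm_pos_iff.2 (sub_ne_zero.2 hab.symm))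
  obtain ⟨c, hlt, hc⟩ := (((tendsto_prodBump_cocompact.comp hfar).eventually_lt_const
    prodBump_zero_pos).and (eventually_ne_atTop 0)).exists
  refine ⟨c, hc, ne_of_gt ?_⟩
  change prodBump (c • (b - a)) < prodBump (c • (a - a))
  rw [sub_self, smul_zero]
  exact hlt

lemma onePointBump_ne_infty {c : ℝ} (hc : c ≠ 0) (a : Euc dx) :
    onePointBump hc a a ≠ onePointBump hc a OnePoint.infty := by
  change prodBump (c • (a - a)) ≠ 0
  simpa only [sub_self, smul_zero] using prodBump_zero_pos.ne'

/-- The continuous functions on the one-point compactification whose restrictions, as functions of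
the first variable, are uniform limits of networks. -/
def netSubalgebra (dx : ℕ) (K : Set (Euc dy)) : Subalgebra ℝ C(OnePoint (Euc dx), ℝ) where
  carrier := {F | NetApprox K fun (x : Euc dx) (_ : Euc dy) => F x}
  mul_mem' hf hg := hf.mul hg
  add_mem' hf hg := hf.add hg
  algebraMap_mem' c := NetApprox.const c

lemma onePointBump_mem_netSubalgebra {c : ℝ} (hc : c ≠ 0) (a : Euc dx) (K : Set (Euc dy)) :
    onePointBump hc a ∈ netSubalgebra dx K :=
  netApprox_prodBump_fst c a

lemma netSubalgebra_separatesPoints (K : Set (Euc dy)) :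
    (netSubalgebra dx K).SeparatesPoints := by
  suffices h : ∀ u v : OnePoint (Euc dx), u ≠ v →
      ∃ (c : ℝ) (hc : c ≠ 0) (a : Euc dx), onePointBump hc a u ≠ onePointBump hc a v by
    intro u v huv
    obtain ⟨c, hc, a, hne⟩ := h u v huv
    exact ⟨_, ⟨_, onePointBump_mem_netSubalgebra hc a K, rfl⟩, hne⟩
  intro u v huv
  induction u using OnePoint.rec with
  | infty =>
    induction v using OnePoint.rec with
    | infty => exact absurd rfl huv
    | coe b => exact ⟨1, one_ne_zero, b, (onePointBump_ne_infty one_ne_zero b).symm⟩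
  | coe a =>
    induction v using OnePoint.rec with
    | infty => exact ⟨1, one_ne_zero, a, onePointBump_ne_infty one_ne_zero a⟩
    | coe b =>
      obtain ⟨c, hc, hne⟩ := exists_onePointBump_ne_of_ne fun h => huv (congrArg _ h)
      exact ⟨c, hc, a, hne⟩

lemma dense_onePointToLp_netSubalgebra (μ : Measure (Euc dx)) [IsFiniteMeasure μ] {p : ℝ≥0∞}
    [Fact (1 ≤ p)] (hp : p ≠ ∞) (K : Set (Euc dy)) :
    Dense (onePointToLp p μ '' (netSubalgebra dx K : Set C(OnePoint (Euc dx), ℝ))) := by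
  refine (denseRange_onePointToLp hp).dense_image (onePointToLp p μ).continuous
    (dense_iff_closure_eq.2 ?_)
  rw [← Subalgebra.topologicalClosure_coe,
    ContinuousMap.subalgebra_topologicalClosure_eq_top_of_separatesPoints _
      (netSubalgebra_separatesPoints K), Algebra.coe_top]

end Density

/-! ### The closed subspace spanned by network jets -/

section BoundedFamily

variable {X E : Type*} [MeasurableSpace X] {μ : Measure X} [IsFiniteMeasure μ]
  [NormedAddCommGroup E] {p : ℝ≥0∞} {M : ℝ}

lemma tendsto_eLpNorm_zero_of_bounded {ι : Type*} {l : Filter ι} [l.IsCountablyGenerated]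
    (hp : p ≠ ∞) {f : ι → X → E} (hmeas : ∀ i, AEStronglyMeasurable (f i) μ)
    (hM : ∀ i x, ‖f i x‖ ≤ M) (hlim : ∀ x, Tendsto (fun i => f i x) l (𝓝 0)) :
    Tendsto (fun i => eLpNorm (f i) p μ) l (𝓝 0) := by
  rcases eq_or_ne p 0 with rfl | hp0
  · simpa only [eLpNorm_exponent_zero] using tendsto_const_nhds
  have hp_pos := ENNReal.toReal_pos hp0 hp
  have hint : Tendsto (fun i => ∫⁻ x, ‖f i x‖ₑ ^ p.toReal ∂μ) l (𝓝 (∫⁻ _, 0 ∂μ)) := by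
    refine tendsto_lintegral_filter_of_dominated_convergence'
      (fun _ => ENNReal.ofReal M ^ p.toReal) (.of_forall fun i => (hmeas i).enorm.pow_const _)
      (.of_forall fun i => ae_of_all _ fun x => ?_) ?_ (ae_of_all _ fun x => ?_)
    · rw [← ofReal_norm]
      gcongr
      exact hM i x
    · rw [lintegral_const]
      finiteness
    · simpa [hp_pos] using (hlim x).enorm.ennrpow_const p.toReal
  simp only [eLpNorm_eq_lintegral_rpow_enorm_toReal hp0 hp]
  simpa [hp_pos] using hint.ennrpow_const (1 / p.toReal)

lemma exists_continuousMap_Lp_of_bounded {Y : Type*} [TopologicalSpace Y]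
    [FirstCountableTopology Y] [Fact (1 ≤ p)] (hp : p ≠ ∞) {f : X → Y → E}
    (hf : ∀ x, Continuous (f x)) (hmeas : ∀ y, AEStronglyMeasurable (fun x => f x y) μ)
    (hM : ∀ x y, ‖f x y‖ ≤ M) :
    ∃ G : C(Y, Lp E p μ), ∀ y, G y =ᵐ[μ] fun x => f x y := by
  have hLp : ∀ y, MemLp (fun x => f x y) p μ := fun y =>
    MemLp.of_bound (hmeas y) M (ae_of_all _ fun x => hM x y)
  refine ⟨⟨fun y => (hLp y).toLp _, continuous_iff_continuousAt.2 fun y => ?_⟩,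
    fun y => (hLp y).coeFn_toLp⟩
  refine (Lp.tendsto_Lp_iff_tendsto_eLpNorm'' _ hLp _ (hLp y)).2 ?_
  refine tendsto_eLpNorm_zero_of_bounded (M := M + M) hp (fun z => (hmeas z).sub (hmeas y))
    (fun z x => (norm_sub_le _ _).trans (add_le_add (hM x z) (hM x y))) fun x => ?_
  exact tendsto_sub_nhds_zero_iff.2 (hf x).continuousAt

end BoundedFamily

section NetFields

variable {dx dy : ℕ} (μ : Measure (Euc dx)) (p : ℝ≥0∞) [Fact (1 ≤ p)] (K : Set (Euc dy))

/-- The families over `K` of jets of GELU networks in the second variable, as functions of the first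
variable in `L^p`. -/
def netFields : Submodule ℝ C(K, Option (Fin dy) → Lp ℝ p μ) where
  carrier := {F | ∃ n : Euc dx → Euc dy → ℝ, IsGeluNet n ∧
    ∀ (y : K) i, F y i =ᵐ[μ] fun x => jet (n x) y i}
  zero_mem' := by
    refine ⟨_, .const 0, fun y i => ?_⟩
    filter_upwards [Lp.coeFn_zero ℝ p μ] with x hx
    refine hx.trans ?_
    cases i <;> simp [jet]
  add_mem' := by
    rintro F G ⟨n, hn, hF⟩ ⟨m, hm, hG⟩
    refine ⟨_, hn.add hm, fun y i => ?_⟩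
    filter_upwards [Lp.coeFn_add (F y i) (G y i), hF y i, hG y i] with x hx hFx hGx
    rw [jet_add (hn.differentiable x y) (hm.differentiable x y), Pi.add_apply, ← hFx, ← hGx]
    exact hx
  smul_mem' := by
    rintro c F ⟨n, hn, hF⟩
    refine ⟨_, hn.const_mul c, fun y i => ?_⟩
    filter_upwards [Lp.coeFn_smul c (F y i), hF y i] with x hx hFx
    simp only [← smul_eq_mul (a := c)]
    rw [jet_const_smul (hn.differentiable x y), Pi.smul_apply, ← hFx]
    exact hx

variable {μ p K} [IsFiniteMeasure μ]

lemma exists_mem_netFields_of_isGeluNet (hp : p ≠ ∞) {n : Euc dx → Euc dy → ℝ} (hn : IsGeluNet n)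
    {M : ℝ} (hM : ∀ x, ∀ y ∈ K, ‖jet (n x) y‖ ≤ M) :
    ∃ G ∈ netFields μ p K, ∀ (y : K) i, G y i =ᵐ[μ] fun x => jet (n x) y i := by
  have hjet : ∀ i, Continuous fun z : Euc dx × Euc dy => jet (n z.1) z.2 i := fun i =>
    (continuous_apply i).comp (continuous_jet_uncurry hn.contDiff)
  choose G hG using fun i => exists_continuousMap_Lp_of_bounded (μ := μ) hp
    (f := fun x (y : K) => jet (n x) y i)
    (fun x => (hjet i).comp ((Continuous.prodMk_right x).comp continuous_subtype_val))
    (fun y => ((hjet i).comp (Continuous.prodMk_left y.1)).aestronglyMeasurable)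
    (fun x y => (norm_le_pi_norm _ i).trans (hM x y y.2))
  exact ⟨ContinuousMap.pi G, ⟨n, hn, fun y i => hG i y⟩, fun y i => hG i y⟩

variable [CompactSpace K]

lemma mem_closure_netFields_of_netApprox (hp : p ≠ ∞) {f : Euc dx → Euc dy → ℝ}
    (hf : NetApprox K f) {F : C(K, Option (Fin dy) → Lp ℝ p μ)}
    (hF : ∀ (y : K) i, F y i =ᵐ[μ] fun x => jet (f x) y i) :
    F ∈ (netFields μ p K).topologicalClosure := by
  refine Metric.mem_closure_iff.2 fun ε hε => ?_
  obtain ⟨δ, hδ, hδε⟩ := exists_pos_mul_lt hε (measureUnivNNReal μ ^ p.toReal⁻¹ : ℝ)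
  obtain ⟨M, hM⟩ := hf.bounded
  obtain ⟨n, hn, hfn⟩ := hf.approx δ hδ
  obtain ⟨G, hGmem, hG⟩ := exists_mem_netFields_of_isGeluNet (μ := μ) hp hn (M := M + δ)
    fun x y hy => by
      rw [← sub_sub_cancel (jet (f x) y) (jet (n x) y)]
      exact (norm_sub_le _ _).trans (add_le_add (hM x y hy) (hfn x y hy))
  refine ⟨G, hGmem, ?_⟩
  rw [dist_eq_norm]
  refine lt_of_le_of_lt ((ContinuousMap.norm_le _ (by positivity)).2 fun y =>
    (pi_norm_le_iff_of_nonneg (by positivity)).2 fun i =>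
      Lp.norm_le_of_ae_bound hδ.le ?_) hδε
  filter_upwards [Lp.coeFn_sub (F y i) (G y i), hF y i, hG y i] with x hx hFx hGx
  rw [ContinuousMap.sub_apply, Pi.sub_apply, hx, Pi.sub_apply, hFx, hGx]
  exact (norm_le_pi_norm (jet (f x) y - jet (n x) y) i).trans (hfn x y y.2)

lemma mem_closure_netFields_of_eq_smul (hp : p ≠ ∞) {k : Euc dy → ℝ} (hk : ContDiff ℝ 1 k)
    (hkK : NetApprox K fun (_ : Euc dx) y => k y) (a : Lp ℝ p μ)
    {F : C(K, Option (Fin dy) → Lp ℝ p μ)} (hF : ∀ y i, F y i = jet k y i • a) :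
    F ∈ (netFields μ p K).topologicalClosure := by
  have hcont : Continuous fun (z : Lp ℝ p μ × K) i => jet k z.2 i • z.1 :=
    continuous_pi fun i => (((continuous_apply i).comp (continuous_jet hk)).comp
      (continuous_subtype_val.comp continuous_snd)).smul continuous_fst
  set Φ := ContinuousMap.curry ⟨_, hcont⟩
  have hdense : Dense (Φ ⁻¹' (netFields μ p K).topologicalClosure) := by
    refine (dense_onePointToLp_netSubalgebra μ hp K).mono ?_
    rintro _ ⟨b, hb, rfl⟩
    refine mem_closure_netFields_of_netApprox hp (NetApprox.mul hb hkK) fun y i => ?_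
    filter_upwards [Lp.coeFn_smul (jet k y i) (onePointToLp p μ b),
      coeFn_onePointToLp (p := p) (μ := μ) b] with x hx hbx
    refine hx.trans ?_
    simp only [← smul_eq_mul (a := b x)]
    rw [jet_const_smul (hk.differentiable one_ne_zero _), Pi.smul_apply, Pi.smul_apply, hbx,
      smul_eq_mul, smul_eq_mul, mul_comm]
  have hclosed := (netFields μ p K).isClosed_topologicalClosure.preimage Φ.continuous
  have hΦa : a ∈ Φ ⁻¹' (netFields μ p K).topologicalClosure := by
    rw [← hclosed.closure_eq]
    exact hdense a
  rwa [show F = Φ a from ContinuousMap.ext fun y => funext (hF y)]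

end NetFields

/-! ### Smoothing in the second variable -/

section Smoothing

variable {d : ℕ} {E : Type*} [NormedAddCommGroup E] [NormedSpace ℝ E] {K : Set (Euc d)}
  {k : Euc d → ℝ} {H : Euc d → Option (Fin d) → E}

/-- The continuous families `H` such that `H z (some j)` is the `j`-th partial derivative of
`H · none` at `z`. Only these line derivatives are needed to integrate by parts. -/
structure IsJetField (H : Euc d → Option (Fin d) → E) : Prop where
  continuous : Continuous H
  hasLineDerivAt : ∀ z j,
    HasLineDerivAt ℝ (fun z => H z none) (H z (some j)) z (EuclideanSpace.single j 1)

lemma integral_mem_of_continuous_of_hasCompactSupport {Z : Type*} [TopologicalSpace Z]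
    [MeasurableSpace Z] [OpensMeasurableSpace Z] [T2Space Z] (ν : Measure Z)
    [IsFiniteMeasureOnCompacts ν] [CompleteSpace E] {S : Submodule ℝ E} (hS : IsClosed (S : Set E))
    {f : Z → E} (hf : Continuous f) (hfc : HasCompactSupport f) (hfS : ∀ z, f z ∈ S) :
    ∫ z, f z ∂ν ∈ S := by
  have : CompleteSpace S := hS.completeSpace_coe
  let f' : Z → S := fun z => ⟨f z, hfS z⟩
  have hf' : Continuous f' := hf.subtype_mk _
  have hfc' : HasCompactSupport f' := HasCompactSupport.intro hfc fun z hz =>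
    Subtype.ext (image_eq_zero_of_notMem_tsupport (f := f) hz)
  have hint : ∫ z, f z ∂ν = ∫ z, f' z ∂ν :=
    S.subtypeL.integral_comp_comm (hf'.integrable_of_hasCompactSupport hfc' (μ := ν))
  exact hint ▸ (∫ z, f' z ∂ν).2

/-- The restrictions to `K` of the translates `y ↦ F (y - z)`, as a function of `z`. Their integral
against a kernel `k` is the convolution of `k` and `F`. -/
def translates (K : Set (Euc d)) {V : Type*} [TopologicalSpace V] (F : C(Euc d, V)) :
    C(Euc d, C(K, V)) :=
  ContinuousMap.curry ⟨fun z : Euc d × K => F (z.2 - z.1), F.continuous.comp (by fun_prop)⟩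

lemma hasCompactSupport_translates {V : Type*} [NormedAddCommGroup V] (hK : IsCompact K)
    {F : C(Euc d, V)} (hF : HasCompactSupport F) : HasCompactSupport (translates K F) := by
  refine HasCompactSupport.intro
    ((hK.prod hF.isCompact).image (continuous_fst.sub continuous_snd)) fun z hz => ?_
  ext1 y
  refine image_eq_zero_of_notMem_tsupport (f := F) fun h => hz ?_
  exact ⟨(y, y - z), ⟨y.2, h⟩, by simp⟩

/-- The jets over `K` of the functions `y ↦ k (y - z) • h z`, as a function of `z`. Their integral
is the jet of the convolution of `k` and `h`. -/
noncomputable def kernelJets (K : Set (Euc d)) (hk : ContDiff ℝ 1 k) (h : C(Euc d, E)) :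
    C(Euc d, C(K, Option (Fin d) → E)) :=
  ContinuousMap.curry ⟨fun z : Euc d × K => fun i => jet k (z.2 - z.1) i • h z.1,
    continuous_pi fun i => (((continuous_apply i).comp (continuous_jet hk)).comp
      (by fun_prop)).smul (h.continuous.comp continuous_fst)⟩

lemma hasCompactSupport_kernelJets (hk : ContDiff ℝ 1 k) {h : C(Euc d, E)}
    (hh : HasCompactSupport h) : HasCompactSupport (kernelJets K hk h) := by
  refine HasCompactSupport.intro hh fun z hz => ?_
  ext1 y
  funext i
  change jet k (y - z) i • h z = 0
  rw [image_eq_zero_of_notMem_tsupport hz, smul_zero]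

lemma hasLineDerivAt_const_sub (hk : Differentiable ℝ k) (y z : Euc d) (j : Fin d) :
    HasLineDerivAt ℝ (fun z => k (y - z)) (-jet k (y - z) (some j)) z
      (EuclideanSpace.single j 1) := by
  have h := (hk (y - z)).hasFDerivAt.comp z ((hasFDerivAt_id z).const_sub y)
  simpa [jet, Function.comp_def] using h.hasLineDerivAt (EuclideanSpace.single j 1)

lemma IsJetField.integral_jet_smul [CompleteSpace E] (hH : IsJetField H) (hHc : HasCompactSupport H)
    (hk : ContDiff ℝ 1 k) (y : Euc d) (i : Option (Fin d)) :
    ∫ z, jet k (y - z) i • H z none = ∫ z, k z • H (y - z) i := by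
  rw [← integral_sub_left_eq_self (fun z => k z • H (y - z) i) _ y]
  simp only [sub_sub_cancel]
  cases i with
  | none => rfl
  | some j =>
    have hint : ∀ i i', Integrable fun z => jet k (y - z) i • H z i' := fun i i' =>
      (((continuous_apply i).comp (continuous_jet hk)).comp (by fun_prop) |>.smul
        ((continuous_apply i').comp hH.continuous)).integrable_of_hasCompactSupport
        (hHc.comp_left (g := fun v : Option (Fin d) → E => v i') rfl).smul_left
    have hparts := integral_bilinear_hasLineDerivAt_right_eq_neg_left_of_integrable
      (μ := (volume : Measure (Euc d))) (B := ContinuousLinearMap.lsmul ℝ ℝ)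
      (by simpa using (hint (some j) none).neg) (hint none (some j)) (hint none none)
      (fun z _ => hasLineDerivAt_const_sub (hk.differentiable one_ne_zero) y z j)
      (fun z _ => hH.hasLineDerivAt z j)
    simp only [ContinuousLinearMap.lsmul_apply, neg_smul, integral_neg, neg_neg] at hparts
    exact hparts.symm

lemma integral_apply_apply {Z : Type*} [MeasurableSpace Z] {ν : Measure Z} {ι : Type*} [Fintype ι]
    [CompactSpace K] [CompleteSpace E] {f : Z → C(K, ι → E)} (hf : Integrable f ν) (y : K) (i : ι) :
    (∫ z, f z ∂ν) y i = ∫ z, f z y i ∂ν :=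
  (((ContinuousLinearMap.proj i).comp
    (ContinuousMap.evalCLM ℝ y) : C(K, ι → E) →L[ℝ] E).integral_comp_comm hf).symm

lemma IsJetField.integral_kernelJets [CompleteSpace E] [CompactSpace K] (hH : IsJetField H)
    (hHc : HasCompactSupport H) (hk : ContDiff ℝ 1 k) :
    ∫ z, kernelJets K hk ⟨fun z => H z none, (continuous_apply none).comp hH.continuous⟩ z =
      ∫ z, k z • translates K ⟨H, hH.continuous⟩ z := by
  have hK : IsCompact K := isCompact_iff_compactSpace.2 inferInstance
  have hker : HasCompactSupport fun z => H z none :=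
    hHc.comp_left (g := fun v : Option (Fin d) → E => v none) rfl
  have hkerInt := (kernelJets K hk ⟨fun z => H z none,
    (continuous_apply none).comp hH.continuous⟩).continuous.integrable_of_hasCompactSupport
      (hasCompactSupport_kernelJets hk hker) (μ := volume)
  have htransInt := (hk.continuous.smul
    (translates K ⟨H, hH.continuous⟩).continuous).integrable_of_hasCompactSupport
      (hasCompactSupport_translates hK hHc).smul_left (μ := volume)
  ext1 y
  funext i
  exact (integral_apply_apply hkerInt y i).trans
    ((hH.integral_jet_smul hHc hk y i).trans (integral_apply_apply htransInt y i).symm)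

lemma tendsto_integral_smul_rescale [CompleteSpace E] (hk : Continuous k) (hki : Integrable k)
    {F : Euc d → E} (hF : Continuous F) (hFc : HasCompactSupport F) :
    Tendsto (fun c : ℝ => ∫ u, k u • F (c⁻¹ • u)) atTop (𝓝 ((∫ u, k u) • F 0)) := by
  obtain ⟨C, hC⟩ := hF.bounded_above_of_compact_support hFc
  rw [← integral_smul_const]
  refine tendsto_integral_filter_of_dominated_convergence (fun u => ‖k u‖ * C)
    (.of_forall fun c => ?_) (.of_forall fun c => ae_of_all _ fun u => ?_) (hki.norm.mul_const C)
    (ae_of_all _ fun u => ?_)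
  · exact (hk.smul (hF.comp (by fun_prop))).aestronglyMeasurable
  · rw [norm_smul]
    gcongr
    exact hC _
  · have hzero : Tendsto (fun c : ℝ => c⁻¹ • u) atTop (𝓝 0) := by
      simpa only [zero_smul] using
        (tendsto_inv_atTop_zero (𝕜 := ℝ)).smul_const u
    exact ((hF.tendsto 0).comp hzero).const_smul _

end Smoothing

section NetClosure

variable {dx dy : ℕ} {μ : Measure (Euc dx)} [IsFiniteMeasure μ] {p : ℝ≥0∞} [Fact (1 ≤ p)]
  {K : Set (Euc dy)} [CompactSpace K] {H : Euc dy → Option (Fin dy) → Lp ℝ p μ}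

lemma IsJetField.integral_prodBump_smul_translates_mem (hp : p ≠ ∞)
    (hH : IsJetField H) (hHc : HasCompactSupport H) {c : ℝ} (hc : c ≠ 0) :
    ∫ u, prodBump u • translates K ⟨H, hH.continuous⟩ (c⁻¹ • u) ∈
      (netFields μ p K).topologicalClosure := by
  have hK : IsCompact K := isCompact_iff_compactSpace.2 inferInstance
  have hk : ContDiff ℝ 1 fun z : Euc dy => prodBump (c • z) := contDiff_prodBump.comp (by fun_prop)
  have hker : HasCompactSupport fun z => H z none :=
    hHc.comp_left (g := fun v : Option (Fin dy) → Lp ℝ p μ => v none) rfl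
  have hsubst := Measure.integral_comp_smul (volume : Measure (Euc dy))
    (fun u => prodBump u • translates K ⟨H, hH.continuous⟩ (c⁻¹ • u)) c
  simp only [smul_smul, inv_mul_cancel₀ hc, one_smul] at hsubst
  rw [← hH.integral_kernelJets hHc hk] at hsubst
  refine (Submodule.smul_mem_iff _ (show |(c ^ Module.finrank ℝ (Euc dy))⁻¹| ≠ 0 by
    positivity)).1 (hsubst ▸ ?_)
  refine integral_mem_of_continuous_of_hasCompactSupport _
    (netFields μ p K).isClosed_topologicalClosure (ContinuousMap.continuous _)
    (hasCompactSupport_kernelJets hk hker) fun z => ?_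
  refine mem_closure_netFields_of_eq_smul hp
    (contDiff_prodBump.comp (by fun_prop : ContDiff ℝ 1 fun y : Euc dy => c • (y - z)))
    (netApprox_prodBump_snd hK c z) (H z none) fun y i => ?_
  exact congrArg (fun v : Option (Fin dy) → ℝ => v i • H z none)
    (jet_comp_sub (fun y => prodBump (c • y)) z y).symm

lemma IsJetField.mem_closure_netFields (hp : p ≠ ∞) (hH : IsJetField H)
    (hHc : HasCompactSupport H) : (⟨fun y : K => H y, hH.continuous.comp continuous_subtype_val⟩ :
      C(K, Option (Fin dy) → Lp ℝ p μ)) ∈ (netFields μ p K).topologicalClosure := by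
  have hK : IsCompact K := isCompact_iff_compactSpace.2 inferInstance
  have hlim := (netFields μ p K).isClosed_topologicalClosure.mem_of_tendsto
    (tendsto_integral_smul_rescale contDiff_prodBump.continuous integrable_prodBump
      (ContinuousMap.continuous _) (hasCompactSupport_translates hK hHc))
    ((eventually_ne_atTop 0).mono fun c hc =>
      hH.integral_prodBump_smul_translates_mem hp hHc hc)
  convert (Submodule.smul_mem_iff _ integral_prodBump_pos.ne').1 hlim using 1
  ext1 y
  exact congrArg H (sub_zero y.1).symm

end NetClosure

/-! ### Differentiation in `L^p` -/

section LpLimits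

variable {α E : Type*} [MeasurableSpace α] {μ : Measure α} [NormedAddCommGroup E] {p : ℝ≥0∞}

lemma norm_Lp_le_of_ae_tendsto [Fact (1 ≤ p)] {F : ℕ → Lp E p μ} {f : Lp E p μ} {C : ℝ}
    (hC : ∀ n, ‖F n‖ ≤ C) (hlim : ∀ᵐ x ∂μ, Tendsto (fun n => F n x) atTop (𝓝 (f x))) : ‖f‖ ≤ C := by
  have hC0 : 0 ≤ C := ENNReal.toReal_nonneg.trans (hC 0)
  refine ENNReal.toReal_le_of_le_ofReal hC0 <|
    (Lp.eLpNorm_lim_le_liminf_eLpNorm (fun n => Lp.aestronglyMeasurable (F n)) f hlim).trans <|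
    liminf_le_of_le (by isBoundedDefault) fun b hb => ?_
  obtain ⟨n, hn⟩ := hb.exists
  rw [← Lp.enorm_def, ← ofReal_norm] at hn
  exact hn.trans (ENNReal.ofReal_le_ofReal (hC n))

lemma coeFn_smul_sum_ae_eq [NormedSpace ℝ E] {ι : Type*} (s : Finset ι) (c : ℝ) {v : ι → Lp E p μ}
    {w : ι → α → E} (hvw : ∀ k, v k =ᵐ[μ] w k) :
    ⇑(c • ∑ k ∈ s, v k) =ᵐ[μ] fun x => c • ∑ k ∈ s, w k x := by
  filter_upwards [Lp.coeFn_smul c (∑ k ∈ s, v k), Lp.coeFn_fun_finsetSum s v,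
    (eventually_all_finset s).2 fun k _ => hvw k] with x hsmul hsum hx
  rw [hsmul, Pi.smul_apply, hsum, Finset.sum_congr rfl hx]

end LpLimits

section HasDerivAtLp

variable {E : Type*} [NormedAddCommGroup E] [NormedSpace ℝ E]

lemma norm_sub_sub_smul_le_of_hasDerivAt {f f' : ℝ → E} (hf : ∀ t, HasDerivAt f (f' t) t)
    {a b C : ℝ} (hC : ∀ t ∈ Set.uIcc a b, ‖f' t - f' a‖ ≤ C) :
    ‖f b - f a - (b - a) • f' a‖ ≤ C * |b - a| := by
  have hderiv : ∀ t, HasDerivAt (fun t => f t - t • f' a) (f' t - f' a) t := fun t => by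
    simpa only [id, one_smul] using (hf t).fun_sub ((hasDerivAt_id t).smul_const (f' a))
  rw [← Real.norm_eq_abs]
  convert (convex_uIcc a b).norm_image_sub_le_of_norm_hasDerivWithin_le
    (fun t _ => (hderiv t).hasDerivWithinAt) hC Set.left_mem_uIcc Set.right_mem_uIcc using 2
  rw [sub_smul]
  abel

lemma tendsto_riemannSum {f f' : ℝ → E} (hf : ∀ t, HasDerivAt f (f' t) t) (hf' : Continuous f') :
    Tendsto (fun n : ℕ => (n : ℝ)⁻¹ • ∑ k ∈ Finset.range n, f' (k / n)) atTop
      (𝓝 (f 1 - f 0)) := by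
  refine Metric.tendsto_atTop.2 fun ε hε => ?_
  obtain ⟨δ, hδ, hclose⟩ := Metric.uniformContinuousOn_iff.1
    ((isCompact_Icc (a := (0 : ℝ)) (b := 1)).uniformContinuousOn_of_continuous hf'.continuousOn)
    (ε / 2) (by positivity)
  obtain ⟨N, hN⟩ := exists_nat_gt δ⁻¹
  refine ⟨N, fun n hn => ?_⟩
  have hnδ : (n : ℝ)⁻¹ < δ := inv_lt_of_inv_lt₀ hδ (hN.trans_le (mod_cast hn))
  have hn0 : 0 < (n : ℝ) := (inv_pos.2 hδ).trans (hN.trans_le (mod_cast hn))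
  have hstep : ∀ k ∈ Finset.range n,
      ‖f ((k + 1 : ℕ) / n) - f (k / n) - (n : ℝ)⁻¹ • f' (k / n)‖ ≤ ε / 2 * (n : ℝ)⁻¹ := by
    intro k hk
    have hk1 : ((k + 1 : ℕ) : ℝ) ≤ n := mod_cast Finset.mem_range.1 hk
    have hsub : ((k + 1 : ℕ) / n - k / n : ℝ) = (n : ℝ)⁻¹ := by push_cast; field_simp; ring
    have hle : (k / n : ℝ) ≤ (k + 1 : ℕ) / n := by gcongr; simp
    have hmean := norm_sub_sub_smul_le_of_hasDerivAt hf (a := k / n) (b := (k + 1 : ℕ) / n)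
      (C := ε / 2) fun t ht => by
        rw [Set.uIcc_of_le hle] at ht
        have h1 : ((k + 1 : ℕ) / n : ℝ) ≤ 1 := (div_le_one hn0).2 hk1
        have h0 : (0 : ℝ) ≤ k / n := by positivity
        refine (dist_eq_norm _ _).symm.trans_le (hclose t ⟨h0.trans ht.1, ht.2.trans h1⟩ _
          ⟨h0, hle.trans h1⟩ ?_).le
        rw [Real.dist_eq, abs_of_nonneg (sub_nonneg.2 ht.1)]
        linarith [ht.2]
    rwa [hsub, abs_of_pos (inv_pos.2 hn0)] at hmean
  have htele : ∑ k ∈ Finset.range n, (f ((k + 1 : ℕ) / n) - f (k / n)) = f 1 - f 0 := by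
    rw [Finset.sum_range_sub fun k : ℕ => f (k / n), div_self hn0.ne', Nat.cast_zero, zero_div]
  rw [dist_comm, dist_eq_norm, ← htele, Finset.smul_sum, ← Finset.sum_sub_distrib]
  calc _ ≤ ∑ _ ∈ Finset.range n, ε / 2 * (n : ℝ)⁻¹ := norm_sum_le_of_le _ hstep
    _ = ε / 2 := by rw [Finset.sum_const, Finset.card_range, nsmul_eq_mul]; field_simp
    _ < ε := half_lt_self hε

variable {α : Type*} [MeasurableSpace α] {μ : Measure α} {p : ℝ≥0∞} [Fact (1 ≤ p)]

/-- The Riemann sums of `φ' · x` converge for every `x`, and Fatou's lemma passes to the limit. -/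
lemma norm_Lp_sub_le_of_hasDerivAt {φ φ' : ℝ → α → E}
    (hφ : ∀ t x, HasDerivAt (φ · x) (φ' t x) t) (hφ' : ∀ x, Continuous (φ' · x))
    {u u' : ℝ → Lp E p μ} (hu : ∀ t, u t =ᵐ[μ] φ t) (hu' : ∀ t, u' t =ᵐ[μ] φ' t) {C : ℝ}
    (hC : ∀ t ∈ Set.Icc (0 : ℝ) 1, ‖u' t‖ ≤ C) : ‖u 1 - u 0‖ ≤ C := by
  have hC0 : 0 ≤ C := (norm_nonneg _).trans (hC 0 ⟨le_rfl, zero_le_one⟩)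
  refine norm_Lp_le_of_ae_tendsto
    (F := fun n : ℕ => (n : ℝ)⁻¹ • ∑ k ∈ Finset.range n, u' (k / n)) (fun n => ?_) ?_
  · have hsum : ‖∑ k ∈ Finset.range n, u' (k / n)‖ ≤ n * C := by
      refine (norm_sum_le_of_le _ fun k hk => hC _ ⟨by positivity, ?_⟩).trans_eq (by simp)
      exact div_le_one_of_le₀ (mod_cast (Finset.mem_range.1 hk).le) (by positivity)
    rw [norm_smul, norm_inv, Real.norm_natCast]
    exact inv_mul_le_of_le_mul₀ (by positivity) hC0 hsum
  · filter_upwards [ae_all_iff.2 fun n : ℕ => coeFn_smul_sum_ae_eq (Finset.range n) (n : ℝ)⁻¹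
      fun k => hu' (k / n), Lp.coeFn_sub (u 1) (u 0), hu 1, hu 0] with x hF hsub h1 h0
    simp only [hF, hsub, Pi.sub_apply, h1, h0]
    exact tendsto_riemannSum (hφ · x) (hφ' x)

lemma norm_Lp_sub_sub_smul_le_of_hasDerivAt {φ φ' : ℝ → α → E}
    (hφ : ∀ t x, HasDerivAt (φ · x) (φ' t x) t) (hφ' : ∀ x, Continuous (φ' · x))
    {u u' : ℝ → Lp E p μ} (hu : ∀ t, u t =ᵐ[μ] φ t) (hu' : ∀ t, u' t =ᵐ[μ] φ' t) {a h C : ℝ}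
    (hC : ∀ s ∈ Set.Icc (0 : ℝ) 1, ‖u' (a + s * h) - u' a‖ ≤ C) :
    ‖u (a + h) - u a - h • u' a‖ ≤ C * |h| := by
  have hderiv : ∀ s x, HasDerivAt (fun s => φ (a + s * h) x - s • h • φ' a x)
      (h • (φ' (a + s * h) x - φ' a x)) s := fun s x => by
    have hline : HasDerivAt (fun s => a + s * h) h s := by
      simpa only [id, one_mul] using ((hasDerivAt_id s).mul_const h).const_add a
    simpa only [id, one_smul, smul_sub, Function.comp_apply] using
      ((hφ (a + s * h) x).scomp s hline).fun_sub ((hasDerivAt_id s).smul_const (h • φ' a x))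
  have hcont : ∀ x, Continuous fun s => h • (φ' (a + s * h) x - φ' a x) := fun x => by
    have := hφ' x
    fun_prop
  have hmean := norm_Lp_sub_le_of_hasDerivAt (p := p) (μ := μ) hderiv hcont
    (u := fun s => u (a + s * h) - s • h • u' a) (u' := fun s => h • (u' (a + s * h) - u' a))
    (fun s => (Lp.coeFn_sub _ _).trans <| (hu _).sub <| (Lp.coeFn_smul _ _).trans <|
      ((Lp.coeFn_smul _ _).trans ((hu' a).const_smul h)).const_smul s)
    (fun s => (Lp.coeFn_smul _ _).trans <|
      ((Lp.coeFn_sub _ _).trans ((hu' _).sub (hu' a))).const_smul h)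
    (C := C * |h|) fun s hs => by
      rw [norm_smul, Real.norm_eq_abs, mul_comm]
      exact mul_le_mul_of_nonneg_right (hC s hs) (abs_nonneg h)
  simpa only [one_mul, zero_mul, add_zero, one_smul, zero_smul, sub_zero, sub_right_comm]
    using hmean

lemma hasDerivAt_Lp {φ φ' : ℝ → α → E}
    (hφ : ∀ t x, HasDerivAt (φ · x) (φ' t x) t) (hφ' : ∀ x, Continuous (φ' · x))
    {u u' : ℝ → Lp E p μ} (hu : ∀ t, u t =ᵐ[μ] φ t) (hu' : ∀ t, u' t =ᵐ[μ] φ' t) {t : ℝ}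
    (hc : ContinuousAt u' t) : HasDerivAt u (u' t) t := by
  rw [hasDerivAt_iff_isLittleO_nhds_zero, Asymptotics.isLittleO_iff]
  intro c hcpos
  obtain ⟨δ, hδ, hclose⟩ := Metric.continuousAt_iff.1 hc c hcpos
  refine Metric.eventually_nhds_iff_ball.2 ⟨δ, hδ, fun h hh => ?_⟩
  rw [mem_ball_zero_iff] at hh
  rw [Real.norm_eq_abs]
  refine norm_Lp_sub_sub_smul_le_of_hasDerivAt hφ hφ' hu hu' fun s hs => ?_
  rw [← dist_eq_norm]
  refine (hclose ?_).le
  rw [dist_eq_norm, add_sub_cancel_left, norm_mul, Real.norm_of_nonneg hs.1]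
  exact (mul_le_of_le_one_left (norm_nonneg h) hs.2).trans_lt hh

end HasDerivAtLp

/-! ### Cutoff -/

section Cutoff

variable {d : ℕ} {E : Type*} [NormedAddCommGroup E] [NormedSpace ℝ E] {B : Set (Euc d)}
  {χ : Euc d → ℝ}

lemma exists_contDiff_hasCompactSupport_eventuallyEq_one {K : Set (Euc d)} (hB : IsOpen B)
    (hK : IsCompact K) (hKB : K ⊆ B) :
    ∃ χ : Euc d → ℝ, ContDiff ℝ 1 χ ∧ HasCompactSupport χ ∧ tsupport χ ⊆ B ∧
      ∀ y ∈ K, χ =ᶠ[𝓝 y] 1 := by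
  obtain ⟨L, hL, hKL, hLB⟩ := exists_compact_between hK hB hKB
  obtain ⟨χ, hzero, hone, -⟩ := exists_contMDiffMap_zero_one_nhds_of_isClosed (n := 1)
    (modelWithCornersSelf ℝ (Euc d)) isOpen_interior.isClosed_compl hK.isClosed
    (Set.disjoint_compl_left_iff_subset.2 hKL)
  have hsupp : Function.support χ ⊆ L := fun y hy => interior_subset <| by
    by_contra hyL
    exact hy (hzero.self_of_nhdsSet y hyL)
  exact ⟨χ, χ.contMDiff.contDiff, .of_support_subset_isCompact hL hsupp,
    (closure_minimal hsupp hL.isClosed).trans hLB,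
    fun y hy => hone.filter_mono (nhds_le_nhdsSet hy)⟩

lemma jet_eq_zero_of_notMem_tsupport {k : Euc d → E} {y : Euc d} (hy : y ∉ tsupport k) :
    jet k y = 0 := by
  rw [jet_congr (notMem_tsupport_iff_eventuallyEq.1 hy)]
  exact norm_le_zero_iff.1 ((norm_jet_const_le 0 y).trans_eq norm_zero)

lemma jetMul_zero_left {ι : Type*} (v : Option ι → E) : jetMul 0 v = 0 := by
  ext (_ | j) <;> simp [jetMul]

lemma continuous_jetMul {ι : Type*} :
    Continuous fun z : (Option ι → ℝ) × (Option ι → E) => jetMul z.1 z.2 := by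
  refine continuous_pi ?_
  rintro (_ | j) <;> simp only [jetMul] <;> fun_prop

lemma continuous_jetMul_jet (hB : IsOpen B) (hχ : ContDiff ℝ 1 χ) (hχB : tsupport χ ⊆ B)
    {G : Euc d → Option (Fin d) → E} (hG : ContinuousOn G B) :
    Continuous fun y => jetMul (jet χ y) (G y) := by
  refine continuous_iff_continuousAt.2 fun y => ?_
  by_cases hy : y ∈ B
  · exact continuous_jetMul.continuousAt.comp
      ((continuous_jet hχ).continuousAt.prodMk (hG.continuousAt (hB.mem_nhds hy)))
  · refine (continuousAt_const (y := (0 : Option (Fin d) → E))).congr ?_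
    filter_upwards [(isClosed_tsupport χ).isOpen_compl.mem_nhds fun h => hy (hχB h)] with w hw
    rw [jet_eq_zero_of_notMem_tsupport hw, jetMul_zero_left]

lemma hasCompactSupport_jetMul_jet (hχ : HasCompactSupport χ) (G : Euc d → Option (Fin d) → E) :
    HasCompactSupport fun y => jetMul (jet χ y) (G y) :=
  HasCompactSupport.intro hχ fun y hy => by
    rw [jet_eq_zero_of_notMem_tsupport hy, jetMul_zero_left]

lemma contDiff_smul_of_tsupport_subset (hB : IsOpen B) (hχ : ContDiff ℝ 1 χ)
    (hχB : tsupport χ ⊆ B) {k : Euc d → E} (hk : ContDiffOn ℝ 1 k B) :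
    ContDiff ℝ 1 fun y => χ y • k y := by
  refine contDiff_iff_contDiffAt.2 fun y => ?_
  by_cases hy : y ∈ B
  · exact hχ.contDiffAt.smul (hk.contDiffAt (hB.mem_nhds hy))
  · refine (contDiffAt_const (c := (0 : E))).congr_of_eventuallyEq ?_
    filter_upwards [notMem_tsupport_iff_eventuallyEq.1 fun h => hy (hχB h)] with w hw
    rw [hw, Pi.zero_apply, zero_smul]

lemma jet_smul_of_tsupport_subset (hB : IsOpen B) (hχ : Differentiable ℝ χ)
    (hχB : tsupport χ ⊆ B) {k : Euc d → E} (hk : DifferentiableOn ℝ k B) (y : Euc d) :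
    jet (fun y => χ y • k y) y = jetMul (jet χ y) (jet k y) := by
  by_cases hy : y ∈ B
  · exact jet_smul (hχ y) (hk.differentiableAt (hB.mem_nhds hy))
  · have hyχ : y ∉ tsupport χ := fun h => hy (hχB h)
    rw [jet_eq_zero_of_notMem_tsupport hyχ, jetMul_zero_left]
    exact jet_eq_zero_of_notMem_tsupport fun h => hyχ (tsupport_smul_subset_left χ k h)

end Cutoff

section JetField

variable {α E : Type*} [MeasurableSpace α] {μ : Measure α} [NormedAddCommGroup E]
  [NormedSpace ℝ E] {p : ℝ≥0∞} [Fact (1 ≤ p)] {d : ℕ}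

lemma coeFn_jetMul {ι : Type*} (a : Option ι → ℝ) {v : Option ι → Lp E p μ}
    {w : α → Option ι → E} (hvw : ∀ i, v i =ᵐ[μ] fun x => w x i) (i : Option ι) :
    (jetMul a v i : Lp E p μ) =ᵐ[μ] fun x => jetMul a (w x) i := by
  have hsmul : ∀ i j, ⇑(a i • v j) =ᵐ[μ] fun x => a i • w x j := fun i j =>
    (Lp.coeFn_smul _ _).trans ((hvw j).const_smul (a i))
  cases i with
  | none => exact hsmul none none
  | some j => exact (Lp.coeFn_add _ _).trans ((hsmul none (some j)).add (hsmul (some j) none))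

lemma isJetField_of_coeFn_ae_eq_jet {f : α → Euc d → E} (hf : ∀ x, ContDiff ℝ 1 (f x))
    {H : Euc d → Option (Fin d) → Lp E p μ} (hH : Continuous H)
    (hHf : ∀ y i, H y i =ᵐ[μ] fun x => jet (f x) y i) : IsJetField H where
  continuous := hH
  hasLineDerivAt z j := by
    let line : ℝ → Euc d := fun t => z + t • EuclideanSpace.single j (1 : ℝ)
    have hline : Continuous line := by fun_prop
    have hlineDeriv : ∀ t, HasDerivAt line (EuclideanSpace.single j 1) t := fun t => by
      simpa only [id, one_smul] using ((hasDerivAt_id t).smul_const _).const_add z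
    have hderiv := hasDerivAt_Lp (φ := fun t x => f x (line t))
      (φ' := fun t x => jet (f x) (line t) (some j)) (t := 0)
      (fun t x => (((hf x).differentiable one_ne_zero) (line t)).hasFDerivAt.comp_hasDerivAt t
        (hlineDeriv t))
      (fun x => (continuous_apply (some j)).comp ((continuous_jet (hf x)).comp hline))
      (fun t => hHf (line t) none) (fun t => hHf (line t) (some j))
      ((continuous_apply (some j)).comp (hH.comp hline)).continuousAt
    simpa [line, HasLineDerivAt] using hderiv

lemma isJetField_jetMul_jet {B : Set (Euc d)} (hB : IsOpen B) {χ : Euc d → ℝ}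
    (hχ : ContDiff ℝ 1 χ) (hχB : tsupport χ ⊆ B) {f : α → Euc d → E}
    (hf : ∀ x, ContDiffOn ℝ 1 (f x) B) {G : Euc d → Option (Fin d) → Lp E p μ}
    (hG : ContinuousOn G B) (hGf : ∀ y ∈ B, ∀ i, G y i =ᵐ[μ] fun x => jet (f x) y i) :
    IsJetField fun y => jetMul (jet χ y) (G y) := by
  refine isJetField_of_coeFn_ae_eq_jet
    (fun x => contDiff_smul_of_tsupport_subset hB hχ hχB (hf x))
    (continuous_jetMul_jet hB hχ hχB hG) fun y i => ?_
  simp only [jet_smul_of_tsupport_subset hB (hχ.differentiable one_ne_zero) hχB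
    ((hf _).differentiableOn one_ne_zero)]
  by_cases hy : y ∈ B
  · exact coeFn_jetMul _ (hGf y hy) i
  · simp only [jet_eq_zero_of_notMem_tsupport fun h => hy (hχB h), jetMul_zero_left]
    exact Lp.coeFn_zero E p μ

end JetField

section Component

variable {dx dy : ℕ} {μ : Measure (Euc dx)} [IsFiniteMeasure μ] {p : ℝ≥0∞} [Fact (1 ≤ p)]

lemma exists_isGeluNet_eLpNorm_jet_sub_le (hp : p ≠ ∞) {B : Set (Euc dy)} (hB : IsOpen B)
    {f : Euc dx → Euc dy → ℝ} (hf : ∀ x, ContDiffOn ℝ 1 (f x) B)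
    {G : Euc dy → Option (Fin dy) → Lp ℝ p μ} (hG : ContinuousOn G B)
    (hGf : ∀ y ∈ B, ∀ i, G y i =ᵐ[μ] fun x => jet (f x) y i) {K : Set (Euc dy)}
    (hK : IsCompact K) (hKB : K ⊆ B) {ε : ℝ} (hε : 0 < ε) :
    ∃ n : Euc dx → Euc dy → ℝ, IsGeluNet n ∧ ∀ y ∈ K, ∀ i,
      AEStronglyMeasurable (fun x => jet (f x) y i - jet (n x) y i) μ ∧
        eLpNorm (fun x => jet (f x) y i - jet (n x) y i) p μ ≤ ENNReal.ofReal ε := by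
  obtain ⟨χ, hχ, hχc, hχB, hχK⟩ := exists_contDiff_hasCompactSupport_eventuallyEq_one hB hK hKB
  have : CompactSpace K := isCompact_iff_compactSpace.1 hK
  obtain ⟨F, ⟨n, hn, hF⟩, hdist⟩ := Metric.mem_closure_iff.1
    ((isJetField_jetMul_jet hB hχ hχB hf hG hGf).mem_closure_netFields
      (K := K) hp (hasCompactSupport_jetMul_jet hχc G)) ε hε
  refine ⟨n, hn, fun y hy i => ?_⟩
  have hχy : jetMul (jet χ y) (G y) = G y := by
    rw [jet_congr (hχK y hy)]
    ext1 (_ | j) <;> simp [jet, jetMul]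
  have hdiff : (fun x => jet (f x) y i - jet (n x) y i) =ᵐ[μ] ⇑(G y i - F ⟨y, hy⟩ i) :=
    ((hGf y (hKB hy) i).symm.sub (hF ⟨y, hy⟩ i).symm).trans (Lp.coeFn_sub _ _).symm
  refine ⟨(Lp.aestronglyMeasurable _).congr hdiff.symm, ?_⟩
  rw [eLpNorm_congr_ae hdiff, ← Lp.enorm_def, ← ofReal_norm, ← dist_eq_norm, ← hχy]
  exact ENNReal.ofReal_le_ofReal <| (dist_le_pi_dist _ _ i).trans <|
    (ContinuousMap.dist_apply_le_dist (⟨y, hy⟩ : K)).trans hdist.le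

end Component

/-! ### Vectors and matrices -/

section Entries

lemma norm_piLp_le_sum {ι : Type*} [Fintype ι] {E : ι → Type*} [∀ i, SeminormedAddCommGroup (E i)]
    (q : ℝ≥0∞) [Fact (1 ≤ q)] (v : PiLp q E) : ‖v‖ ≤ ∑ i, ‖v i‖ := by
  classical
  calc ‖v‖ = ‖∑ i, PiLp.single q i (v i)‖ := by
        congr 1
        ext i
        simp
    _ ≤ ∑ i, ‖PiLp.single q i (v i)‖ := norm_sum_le _ _
    _ = ∑ i, ‖v i‖ := by simp only [PiLp.norm_single]

lemma frobenius_norm_le_sum {m n E : Type*} [Fintype m] [Fintype n] [NormedAddCommGroup E]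
    (A : Matrix m n E) : ‖A‖ ≤ ∑ ij : m × n, ‖A ij.1 ij.2‖ := by
  rw [Fintype.sum_prod_type]
  exact (norm_piLp_le_sum 2 (WithLp.toLp 2 fun i => WithLp.toLp 2 (A i))).trans
    (Finset.sum_le_sum fun i _ => norm_piLp_le_sum 2 (WithLp.toLp 2 (A i)))

variable {α : Type*} [MeasurableSpace α] {μ : Measure α} {p : ℝ≥0∞} [Fact (1 ≤ p)]

lemma eLpNorm_le_card_mul {ι E F : Type*} [Fintype ι] [NormedAddCommGroup E]
    [NormedAddCommGroup F] {f : α → E} {e : ι → α → F} (he : ∀ i, AEStronglyMeasurable (e i) μ)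
    (hfe : ∀ x, ‖f x‖ ≤ ∑ i, ‖e i x‖) {C : ℝ≥0∞} (hC : ∀ i, eLpNorm (e i) p μ ≤ C) :
    eLpNorm f p μ ≤ Fintype.card ι * C :=
  calc eLpNorm f p μ ≤ eLpNorm (∑ i, fun x => ‖e i x‖) p μ :=
        eLpNorm_mono_real fun x => (hfe x).trans_eq (by rw [Finset.sum_apply])
    _ ≤ ∑ i, eLpNorm (fun x => ‖e i x‖) p μ := eLpNorm_sum_le (fun i _ => (he i).norm) Fact.out
    _ ≤ ∑ _ : ι, C := Finset.sum_le_sum fun i _ => (eLpNorm_norm (e i)).trans_le (hC i)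
    _ = Fintype.card ι * C := by rw [Finset.sum_const, nsmul_eq_mul, Finset.card_univ]

lemma exists_continuousOn_Lp_comp {β E F : Type*} [TopologicalSpace β] [NormedAddCommGroup E]
    [NormedSpace ℝ E] [NormedAddCommGroup F] [NormedSpace ℝ F] {B : Set β} {f : β → α → E}
    (hf : ∀ y : B, MemLp (f y) p μ) (hc : Continuous fun y : B => (hf y).toLp (f y))
    (L : E →L[ℝ] F) :
    ∃ G : β → Lp F p μ, ContinuousOn G B ∧ ∀ y ∈ B, G y =ᵐ[μ] fun x => L (f y x) := by
  let G : B → Lp F p μ := fun y => L.compLp ((hf y).toLp (f y))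
  have hextend : ∀ y : B, Function.extend Subtype.val G 0 (y : β) = G y :=
    Subtype.val_injective.extend_apply G 0
  refine ⟨Function.extend Subtype.val G 0, continuousOn_iff_continuous_domRestrict.2 ?_,
    fun y hy => ?_⟩
  · rw [show B.domRestrict (Function.extend Subtype.val G 0) = G from funext hextend]
    exact (L.compLpL p μ).continuous.comp hc
  rw [hextend ⟨y, hy⟩]
  filter_upwards [L.coeFn_compLp ((hf ⟨y, hy⟩).toLp (f y)), (hf ⟨y, hy⟩).coeFn_toLp]
    with x hL hx
  rw [hL, hx]

end Entries

section Vector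

variable {dx dy dg : ℕ} {g : Euc dx → Euc dy → Euc dg}

lemma jet_euclidean_apply {d m : ℕ} {k : Euc d → Euc m} {y : Euc d} (hk : DifferentiableAt ℝ k y)
    (o : Option (Fin d)) (i : Fin m) : jet (fun y => k y i) y o = jet k y o i := by
  cases o with
  | none => rfl
  | some j =>
    have hcomp := (EuclideanSpace.proj (𝕜 := ℝ) i).hasFDerivAt.comp y hk.hasFDerivAt
    exact DFunLike.congr_fun hcomp.fderiv _

lemma exists_denseNet_jet_eq {n : Fin dg → Euc dx → Euc dy → ℝ} (hn : ∀ i, IsGeluNet (n i)) :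
    ∃ θ : DenseNet dg (dx + dy), 0 < θ.depth ∧
      ∀ x y o i, jet (θ.toFun x) y o i = jet (n i x) y o := by
  obtain ⟨θ, hdepth, hθ⟩ := exists_denseNet_of_forall_isNet gelu_sub_gelu_neg hn
  have heval : ∀ i x y, θ.toFun x y i = n i x y := fun i x y => hθ (x, y) i
  refine ⟨θ, hdepth, fun x y o i => ?_⟩
  have hdiff : DifferentiableAt ℝ (θ.toFun x) y := differentiableAt_euclidean.2 fun i => by
    simpa only [heval] using (hn i).differentiable x y
  simp only [← jet_euclidean_apply hdiff, heval]

variable {μ : Measure (Euc dx)} {p : ℝ≥0∞} [Fact (1 ≤ p)] {B K : Set (Euc dy)}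

attribute [local instance] Matrix.frobeniusNormedSpace in
lemma exists_continuousOn_Lp_jet
    (hgLp : ∀ y : B, MemLp (fun x => g x y) p μ)
    (hgcont : Continuous fun y : B => (hgLp y).toLp (fun x => g x y))
    (hDgLp : ∀ y : B, MemLp (fun x => jacobianY g x y) p μ)
    (hDgcont : Continuous fun y : B => (hDgLp y).toLp (fun x => jacobianY g x y)) (i : Fin dg) :
    ∃ G : Euc dy → Option (Fin dy) → Lp ℝ p μ, ContinuousOn G B ∧
      ∀ y ∈ B, ∀ o, G y o =ᵐ[μ] fun x => jet (g x) y o i := by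
  obtain ⟨G₀, hG₀, hG₀g⟩ := exists_continuousOn_Lp_comp (f := fun y x => g x y) hgLp hgcont
    (EuclideanSpace.proj i)
  choose G₁ hG₁ hG₁g using fun j => exists_continuousOn_Lp_comp (f := fun y x => jacobianY g x y)
    hDgLp hDgcont (Matrix.entryLinearMap ℝ ℝ i j).toContinuousLinearMap
  refine ⟨fun y o => o.elim (G₀ y) (G₁ · y), continuousOn_pi.2 ?_, ?_⟩
  · rintro (_ | j)
    exacts [hG₀, hG₁ j]
  · rintro y hy (_ | j)
    exacts [hG₀g y hy, hG₁g j y hy]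

lemma exists_denseNet_eLpNorm_jet_sub_le [IsFiniteMeasure μ] (hp : p ≠ ∞) (hB : IsOpen B)
    (hg : ∀ x, ContDiffOn ℝ 1 (g x) B) {G : Fin dg → Euc dy → Option (Fin dy) → Lp ℝ p μ}
    (hG : ∀ i, ContinuousOn (G i) B)
    (hGg : ∀ i, ∀ y ∈ B, ∀ o, G i y o =ᵐ[μ] fun x => jet (g x) y o i) (hK : IsCompact K)
    (hKB : K ⊆ B) {ε : ℝ} (hε : 0 < ε) :
    ∃ θ : DenseNet dg (dx + dy), 0 < θ.depth ∧ ∀ y ∈ K, ∀ o i,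
      AEStronglyMeasurable (fun x => (jet (g x) y o - jet (θ.toFun x) y o) i) μ ∧
        eLpNorm (fun x => (jet (g x) y o - jet (θ.toFun x) y o) i) p μ ≤ ENNReal.ofReal ε := by
  have hjet : ∀ i x, ∀ y ∈ B, ∀ o, jet (fun y => g x y i) y o = jet (g x) y o i :=
    fun i x y hy o => jet_euclidean_apply
      (((hg x).differentiableOn one_ne_zero).differentiableAt (hB.mem_nhds hy)) o i
  choose n hn hclose using fun i => exists_isGeluNet_eLpNorm_jet_sub_le hp hB
    (f := fun x y => g x y i) (fun x => contDiffOn_euclidean.1 (hg x) i) (hG i)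
    (fun y hy o => (hGg i y hy o).trans (.of_eq (funext fun x => (hjet i x y hy o).symm)))
    hK hKB hε
  obtain ⟨θ, hdepth, hθ⟩ := exists_denseNet_jet_eq hn
  refine ⟨θ, hdepth, fun y hy o i => ?_⟩
  simpa only [PiLp.sub_apply, hθ, ← hjet i _ y (hKB hy) o] using hclose i y hy o

lemma exists_denseNet_eLpNorm_sub_le [IsFiniteMeasure μ] (hp : p ≠ ∞) (hB : IsOpen B)
    (hg : ∀ x, ContDiffOn ℝ 1 (g x) B) (hgLp : ∀ y : B, MemLp (fun x => g x y) p μ)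
    (hgcont : Continuous fun y : B => (hgLp y).toLp (fun x => g x y))
    (hDgLp : ∀ y : B, MemLp (fun x => jacobianY g x y) p μ)
    (hDgcont : Continuous fun y : B => (hDgLp y).toLp (fun x => jacobianY g x y))
    (hK : IsCompact K) (hKB : K ⊆ B) {ε : ℝ} (hε : 0 < ε) :
    ∃ θ : DenseNet dg (dx + dy), 0 < θ.depth ∧ ∀ y ∈ K,
      eLpNorm (fun x => g x y - θ.toFun x y) p μ ≤ ENNReal.ofReal ε ∧
        eLpNorm (fun x => jacobianY g x y - jacobianY θ.toFun x y) p μ ≤ ENNReal.ofReal ε := by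
  set N : ℕ := dg + dg * dy + 1
  have hsmall : ∀ m : ℕ, m ≤ N → m * ENNReal.ofReal (ε / N) ≤ ENNReal.ofReal ε := fun m hm => by
    calc m * ENNReal.ofReal (ε / N) ≤ N * ENNReal.ofReal (ε / N) := by gcongr
      _ = ENNReal.ofReal ε := by
        have hN : (N : ℝ) ≠ 0 := by positivity
        rw [← ENNReal.ofReal_natCast, ← ENNReal.ofReal_mul N.cast_nonneg, mul_div_cancel₀ ε hN]
  choose G hG hGg using exists_continuousOn_Lp_jet hgLp hgcont hDgLp hDgcont
  obtain ⟨θ, hdepth, hθ⟩ := exists_denseNet_eLpNorm_jet_sub_le hp hB hg hG hGg hK hKB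
    (show 0 < ε / N by positivity)
  refine ⟨θ, hdepth, fun y hy => ⟨?_, ?_⟩⟩
  · refine (eLpNorm_le_card_mul (fun i => (hθ y hy none i).1) (fun x => norm_piLp_le_sum 2 _)
      fun i => (hθ y hy none i).2).trans (hsmall _ ?_)
    rw [Fintype.card_fin]
    omega
  · refine (eLpNorm_le_card_mul (fun ij : Fin dg × Fin dy => (hθ y hy (some ij.2) ij.1).1)
      (fun x => frobenius_norm_le_sum _) fun ij => (hθ y hy (some ij.2) ij.1).2).trans
      (hsmall _ ?_)
    rw [Fintype.card_prod, Fintype.card_fin, Fintype.card_fin]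
    omega

end Vector

lemma lintegral_enorm_rpow_eq_eLpNorm_rpow {α E : Type*} [MeasurableSpace α] {μ : Measure α}
    [NormedAddCommGroup E] {p : ℝ≥0∞} (hp0 : p ≠ 0) (hp : p ≠ ∞) (f : α → E) :
    ∫⁻ x, ‖f x‖ₑ ^ p.toReal ∂μ = eLpNorm f p μ ^ p.toReal := by
  rw [eLpNorm_eq_eLpNorm' hp0 hp, lintegral_rpow_enorm_eq_rpow_eLpNorm' (ENNReal.toReal_pos hp0 hp)]

theorem theoremC1_general {dx dy dg : ℕ} {B : Set (Euc dy)} (hB : IsOpen B)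
    {g : Euc dx → Euc dy → Euc dg} (hg : ∀ x, ContDiffOn ℝ 1 (g x) B) {μ : Measure (Euc dx)}
    [IsFiniteMeasure μ] {p : ℝ≥0∞} [Fact (1 ≤ p)] (hp : p ≠ ∞)
    (hgLp : ∀ y : B, MemLp (fun x => g x y) p μ)
    (hgcont : Continuous fun y : B => (hgLp y).toLp (fun x => g x y))
    (hDgLp : ∀ y : B, MemLp (fun x => jacobianY g x y) p μ)
    (hDgcont : Continuous fun y : B => (hDgLp y).toLp (fun x => jacobianY g x y))
    {ε : ℝ} (hε : 0 < ε) {K : Set (Euc dy)} (hK : IsCompact K) (hKB : K ⊆ B) :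
    ∃ θ : DenseNet dg (dx + dy), 0 < θ.depth ∧
      (⨆ y ∈ K, ((∫⁻ x, ‖g x y - θ.toFun x y‖ₑ ^ p.toReal ∂μ) +
          (∫⁻ x, ‖jacobianY g x y - jacobianY θ.toFun x y‖ₑ ^ p.toReal ∂μ)))
        < ENNReal.ofReal (ε ^ p.toReal) := by
  have hp1 : 1 ≤ p := Fact.out
  have hr1 : 1 ≤ p.toReal := ENNReal.toReal_mono hp hp1
  have hp0 : p ≠ 0 := (zero_lt_one.trans_le hp1).ne'
  obtain ⟨θ, hdepth, hθ⟩ := exists_denseNet_eLpNorm_sub_le hp hB hg hgLp hgcont hDgLp hDgcont hK hKB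
    (show 0 < ε / 4 by positivity)
  refine ⟨θ, hdepth, (iSup₂_le (a := ENNReal.ofReal ((ε / 2) ^ p.toReal)) fun y hy => ?_).trans_lt
    ((ENNReal.ofReal_lt_ofReal_iff (by positivity)).2
      (Real.rpow_lt_rpow (by positivity) (half_lt_self hε) (by positivity)))⟩
  rw [lintegral_enorm_rpow_eq_eLpNorm_rpow hp0 hp, lintegral_enorm_rpow_eq_eLpNorm_rpow hp0 hp]
  calc _ ≤ ENNReal.ofReal (ε / 4) ^ p.toReal + ENNReal.ofReal (ε / 4) ^ p.toReal := by
        gcongr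
        exacts [(hθ y hy).1, (hθ y hy).2]
    _ ≤ (ENNReal.ofReal (ε / 4) + ENNReal.ofReal (ε / 4)) ^ p.toReal :=
        ENNReal.add_rpow_le_rpow_add _ _ hr1
    _ = ENNReal.ofReal ((ε / 2) ^ p.toReal) := by
        rw [← ENNReal.ofReal_add (by positivity) (by positivity),
          show ε / 4 + ε / 4 = ε / 2 by ring, ENNReal.ofReal_rpow_of_pos (by positivity)]

theorem theoremC1 (dx dy dg : ℕ)
    (B : Set (EuclideanSpace ℝ (Fin dy))) (hB : IsOpen B)
    (g : EuclideanSpace ℝ (Fin dx) → EuclideanSpace ℝ (Fin dy) → EuclideanSpace ℝ (Fin dg))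
    (hg : ContDiffOn ℝ 1 (Function.uncurry g) (Set.univ ×ˢ B))
    (μ : Measure (EuclideanSpace ℝ (Fin dx))) [IsProbabilityMeasure μ]
    (p : ℝ≥0∞) [Fact (1 ≤ p)] (hp : p ≠ ∞)
    (hgLp : ∀ y : B, MemLp (fun x => g x y) p μ)
    (hgcont : Continuous fun y : B => (hgLp y).toLp (fun x => g x y))
    (hDgLp : ∀ y : B, MemLp (fun x => jacobianY g x y) p μ)
    (hDgcont : Continuous fun y : B => (hDgLp y).toLp (fun x => jacobianY g x y))
    (ε : ℝ) (hε : 0 < ε)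
    (K : Set (EuclideanSpace ℝ (Fin dy))) (hK : IsCompact K) (hKB : K ⊆ B) :
    ∃ θ : DenseNet dg (dx + dy), 0 < θ.depth ∧
      (⨆ y ∈ K, ((∫⁻ x, ‖g x y - θ.toFun x y‖ₑ ^ p.toReal ∂μ) +
          (∫⁻ x, ‖jacobianY g x y - jacobianY θ.toFun x y‖ₑ ^ p.toReal ∂μ)))
        < ENNReal.ofReal (ε ^ p.toReal) :=
  theoremC1_general hB
    (fun x => hg.comp (contDiff_prodMk_right x).contDiffOn fun _ hy => ⟨trivial, hy⟩)
    hp hgLp hgcont hDgLp hDgcont hε hK hKB
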